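/- Let $K$ be a field of characteristic $p>0$ and let $n\ge 0$ be an integer. For a $K$-algebra $R$ let $R[F;\sigma]$ be the skew polynomial ring with $F\lambda=\lambda^pF$ for $\lambda\in R$, and put $$U_n(R)=\Bigl\{1+\sum_{i=1}^n\lambda_iF^i\in R[F;\sigma]^\times \;\Big|\; \lambda_i^{p^{\,n-i+1}}=0 \text{ for } 1\le i\le n\Bigr\},$$ a subgroup of $R[F;\sigma]^\times$ normalized by the constants $R^\times=\mathbb{G}_m(R)$. Elements of $R[F;\sigma]$ act on $R$ by $\bigl(\sum_i\lambda_iF^i\bigr)*\mu=\sum_i\lambda_i\mu^{p^i}$, and $\mathbb{G}_a(R)=R$ acts on $R$ by translations $\alpha*\mu=\mu+\alpha$. These define the affine group scheme $G=\mathbb{G}_a\rtimes U_n\rtimes\mathbb{G}_m$ over $K$ (where $U_n\rtimes\mathbb{G}_m$ acts on $\mathbb{G}_a$ by the first formula and $\mathbb{G}_m$ acts on $U_n$ by conjugation) and an action of $G$ on the affine line $\mathbb{A}^1=\operatorname{Spec}K[T^{-1}]$, given on $R$-valued points $\mu\in\mathbb{A}^1(R)=R$ by $$(\alpha,u,\lambda_0)*\mu=\alpha+u*(\lambda_0\mu)\qquad(\alpha\in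 R,\ u\in U_n(R),\ \lambda_0\in R^\times).$$ Let $\Gamma_{p,n}\subset\mathbb{N}$ be the additive monoid generated by $p^n$ and the numbers $p^n-p^j$ for $0\le j\le n-1$, and let $$X_{p,n}=\operatorname{Spec}K\bigl[T^{\Gamma_{p,n}}\bigr]\cup\operatorname{Spec}K[T^{-1}]$$ be the $K$-scheme obtained by gluing the two affine schemes along their common open subscheme $\operatorname{Spec}K[T^{\pm1}]$. Then the action of $G=\mathbb{G}_a\rtimes U_n\rtimes\mathbb{G}_m$ on $\mathbb{A}^1$ extends to $X_{p,n}$: there is an action of the group scheme $G$ on the $K$-scheme $X_{p,n}$ for which the open inclusion $\mathbb{A}^1=\operatorname{Spec}K[T^{-1}]\subset X_{p,n}$ is $G$-equivariant. -/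

import Mathlib

open CategoryTheory MonoidalCategory CartesianMonoidalCategory AlgebraicGeometry Opposite Limits

universe u

namespace SkewAction

noncomputable section

section SkewRing

set_option linter.unusedSectionVars false
set_option linter.unusedVariables false

variable (K : Type u) [Field K] (p : ℕ) [Fact p.Prime] [CharP K p]
variable (R : Type u) [CommRing R] [Algebra K R]

/-- Every `K`-algebra (including the zero ring) satisfies the Frobenius identity. -/
theorem add_pow_p {R : Type u} [CommRing R] [Algebra K R] (a b : R) (i : ℕ) :
    (a + b) ^ p ^ i = a ^ p ^ i + b ^ p ^ i := by
  rcases subsingleton_or_nontrivial R with h | h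
  · exact Subsingleton.elim _ _
  · have : CharP R p := charP_of_injective_algebraMap (algebraMap K R).injective p
    exact add_pow_char_pow a b p i

/-- The `i`-th power of the Frobenius endomorphism of a `K`-algebra. -/
def frob (i : ℕ) : R →+* R where
  toFun a := a ^ p ^ i
  map_one' := one_pow _
  map_mul' a b := mul_pow a b _
  map_zero' := zero_pow (pow_ne_zero _ (Fact.out : p.Prime).ne_zero)
  map_add' a b := add_pow_p K p a b i

/-- `ℕ` acts on `R` through powers of the Frobenius map. -/
abbrev frobAction : MulSemiringAction (Multiplicative ℕ) R where
  smul m a := frob K p R m.toAdd a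
  one_smul a := by change a ^ p ^ 0 = a; simp
  mul_smul m m' a := by
    change a ^ p ^ (m.toAdd + m'.toAdd) = (a ^ p ^ m'.toAdd) ^ p ^ m.toAdd
    rw [← pow_mul, ← pow_add, add_comm]
  smul_zero m := map_zero (frob K p R m.toAdd)
  smul_add m := map_add (frob K p R m.toAdd)
  smul_one m := map_one (frob K p R m.toAdd)
  smul_mul m := map_mul (frob K p R m.toAdd)

/-- The skew polynomial ring `R[F; σ]` for the Frobenius map `σ`, in which `F a = a ^ p F`. -/
def SkewPoly (_K : Type u) (_p : ℕ) (R : Type u) [CommRing R] : Type u := SkewPolynomial R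

instance : Ring (SkewPoly K p R) :=
  letI := frobAction K p R
  inferInstanceAs (Ring (SkewPolynomial R))

variable {K p R}

namespace SkewPoly

/-- The coefficient of `F ^ i`. -/
def coeff (P : SkewPoly K p R) (i : ℕ) : R := SkewPolynomial.coeff P i

theorem ext {P Q : SkewPoly K p R} (h : ∀ i, P.coeff i = Q.coeff i) : P = Q :=
  SkewPolynomial.ext h

theorem coeff_add (P Q : SkewPoly K p R) (i : ℕ) :
    (P + Q).coeff i = P.coeff i + Q.coeff i :=
  SkewPolynomial.coeff_add P Q i

theorem coeff_one (i : ℕ) : (1 : SkewPoly K p R).coeff i = if 0 = i then 1 else 0 :=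
  letI := frobAction K p R
  SkewPolynomial.coeff_one i

theorem coeff_mul (P Q : SkewPoly K p R) (k : ℕ) :
    (P * Q).coeff k =
      ∑ ij ∈ Finset.HasAntidiagonal.antidiagonal k, P.coeff ij.1 * Q.coeff ij.2 ^ p ^ ij.1 := by
  let _ := frobAction K p R
  refine (SkewMonoidAlgebra.coeff_mul_antidiagonal_of_finset (k := R) (G := Multiplicative ℕ)
    P Q (Multiplicative.ofAdd k)
    ((Finset.HasAntidiagonal.antidiagonal k).map (Equiv.prodCongr Multiplicative.ofAdd
      Multiplicative.ofAdd).toEmbedding) ?_).trans ?_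
  · rintro ⟨a, b⟩
    simp only [Finset.mem_map]
    constructor
    · rintro ⟨⟨i, j⟩, h, e⟩
      cases e
      rw [Finset.HasAntidiagonal.mem_antidiagonal] at h
      exact congrArg Multiplicative.ofAdd h
    · intro h
      exact ⟨(a.toAdd, b.toAdd), Finset.HasAntidiagonal.mem_antidiagonal.2
        (congrArg Multiplicative.toAdd h), rfl⟩
  · rw [Finset.sum_map]; rfl

/-- The skew polynomial `∑ cᵢ Fⁱ` with prescribed coefficients. -/
def ofCoeff (c : ℕ →₀ R) : SkewPoly K p R :=
  (SkewMonoidAlgebra.ofCoeff (c.mapDomain Multiplicative.ofAdd) :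
    SkewMonoidAlgebra R (Multiplicative ℕ))

theorem coeff_ofCoeff (c : ℕ →₀ R) (i : ℕ) : (ofCoeff c : SkewPoly K p R).coeff i = c i :=
  Finsupp.mapDomain_apply Multiplicative.ofAdd.injective c i

theorem coeff_finite (P : SkewPoly K p R) : (Function.support P.coeff).Finite :=
  (SkewPolynomial.support (R := R) P).finite_toSet.subset fun i hi => by
    rw [Finset.mem_coe]
    exact SkewPolynomial.mem_support_iff.2 hi


/-- The coefficients as a finitely supported function. -/
def toFinsupp (P : SkewPoly K p R) : ℕ →₀ R :=
  Finsupp.ofSupportFinite P.coeff P.coeff_finite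

/-- The additive polynomial `∑ cᵢ x ^ (p ^ i)` attached to `P = ∑ cᵢ Fⁱ`, evaluated at `a`. -/
def eval (P : SkewPoly K p R) (a : R) : R := P.toFinsupp.sum fun i c => c * a ^ p ^ i

theorem eval_eq_sum (P : SkewPoly K p R) (a : R) (N : ℕ) (hN : ∀ i, N ≤ i → P.coeff i = 0) :
    P.eval a = ∑ i ∈ Finset.range N, P.coeff i * a ^ p ^ i := by
  refine Finsupp.sum_of_support_subset _ ?_ _ (fun i _ => zero_mul _)
  intro i hi
  rw [Finsupp.mem_support_iff] at hi
  by_contra h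
  exact hi (hN i (by simpa using h))

theorem exists_bound (P : SkewPoly K p R) : ∃ N, ∀ i, N ≤ i → P.coeff i = 0 := by
  obtain ⟨N, hN⟩ := P.coeff_finite.bddAbove
  refine ⟨N + 1, fun i hi => ?_⟩
  by_contra h
  exact absurd (hN h) (by omega)

theorem eval_add (P : SkewPoly K p R) (a b : R) : P.eval (a + b) = P.eval a + P.eval b := by
  obtain ⟨N, hN⟩ := P.exists_bound
  simp only [eval_eq_sum P _ N hN, add_pow_p K, mul_add, Finset.sum_add_distrib]

theorem eval_one (a : R) : (1 : SkewPoly K p R).eval a = a := by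
  rw [eval_eq_sum 1 a 1 (fun i hi => by rw [coeff_one, if_neg (by omega)])]
  simp [coeff_one]

theorem eval_mul (P Q : SkewPoly K p R) (a : R) : (P * Q).eval a = P.eval (Q.eval a) := by
  obtain ⟨N, hN⟩ := P.exists_bound
  obtain ⟨M, hM⟩ := Q.exists_bound
  have hcoeff : ∀ k, N + M ≤ k → (P * Q).coeff k = 0 := by
    intro k hk
    rw [coeff_mul]
    refine Finset.sum_eq_zero fun ij hij => ?_
    rw [Finset.HasAntidiagonal.mem_antidiagonal] at hij
    by_cases h : N ≤ ij.1
    · rw [hN _ h, zero_mul]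
    · rw [hM _ (by omega), zero_pow (pow_ne_zero _ (Fact.out : p.Prime).ne_zero), mul_zero]
  rw [eval_eq_sum _ _ _ hcoeff, eval_eq_sum P _ N hN, eval_eq_sum Q _ M hM]
  have h1 : ∀ i, (∑ j ∈ Finset.range M, Q.coeff j * a ^ p ^ j) ^ p ^ i =
      ∑ j ∈ Finset.range M, Q.coeff j ^ p ^ i * a ^ p ^ (i + j) := fun i => by
    refine (map_sum (frob K p R i) _ _).trans (Finset.sum_congr rfl fun j _ => ?_)
    change (Q.coeff j * a ^ p ^ j) ^ p ^ i = _
    rw [mul_pow, ← pow_mul, ← pow_add, add_comm i j]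
  simp only [h1, coeff_mul, Finset.sum_mul, Finset.mul_sum]
  rw [← Finset.sum_product', Finset.sum_sigma']
  symm
  refine Finset.sum_bij_ne_zero (fun ij _ _ => (⟨ij.1 + ij.2, ij⟩ : Σ _ : ℕ, ℕ × ℕ)) ?_ ?_ ?_ ?_
  · rintro ⟨i, j⟩ h _
    simp only [Finset.mem_product, Finset.mem_range] at h
    simp only [Finset.mem_sigma, Finset.mem_range, Finset.HasAntidiagonal.mem_antidiagonal]
    exact ⟨by omega, trivial⟩
  · rintro ⟨i, j⟩ _ _ ⟨i', j'⟩ _ _ h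
    simpa using (congrArg Sigma.snd (eq_of_heq (heq_of_eq h)))
  · rintro ⟨k, i, j⟩ h hne
    simp only [Finset.mem_sigma, Finset.mem_range, Finset.HasAntidiagonal.mem_antidiagonal] at h
    obtain ⟨h, rfl⟩ := h
    have hi : i < N := by
      by_contra hi
      exact hne (by simp [hN i (by omega)])
    have hj : j < M := by
      by_contra hj
      exact hne (by
        simp [hM j (by omega), zero_pow (pow_ne_zero _ (Fact.out : p.Prime).ne_zero)])
    refine ⟨(i, j), by simp [hi, hj], ?_, rfl⟩
    intro h0
    refine hne ?_
    rw [← h0]; ring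
  · rintro ⟨i, j⟩ _ _
    ring

variable {S : Type u} [CommRing S] [Algebra K S]

/-- Applying an algebra homomorphism to all coefficients. -/
def map (f : R →ₐ[K] S) : SkewPoly K p R →* SkewPoly K p S where
  toFun P := ofCoeff (P.toFinsupp.mapRange f (map_zero f))
  map_one' := by
    refine ext fun i => ?_
    rw [coeff_ofCoeff, Finsupp.mapRange_apply, coeff_one]
    change f ((1 : SkewPoly K p R).coeff i) = _
    rw [coeff_one]; split_ifs <;> simp
  map_mul' P Q := by
    refine ext fun i => ?_
    rw [coeff_ofCoeff, Finsupp.mapRange_apply, coeff_mul]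
    change f ((P * Q).coeff i) = _
    simp only [coeff_mul, map_sum, map_mul, map_pow, coeff_ofCoeff, Finsupp.mapRange_apply]
    rfl

theorem coeff_map (f : R →ₐ[K] S) (P : SkewPoly K p R) (i : ℕ) :
    (map f P).coeff i = f (P.coeff i) :=
  coeff_ofCoeff _ i

theorem eval_map (f : R →ₐ[K] S) (P : SkewPoly K p R) (a : R) :
    (map f P).eval (f a) = f (P.eval a) := by
  obtain ⟨N, hN⟩ := P.exists_bound
  rw [eval_eq_sum P _ N hN,
    eval_eq_sum (map f P) _ N fun i hi => by rw [coeff_map, hN i hi, map_zero]]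
  simp [coeff_map]

variable (K p R) in
/-- The constant skew polynomials. -/
def const : R →* SkewPoly K p R where
  toFun a := ofCoeff (Finsupp.single 0 a)
  map_one' := by
    refine ext fun i => ?_
    rw [coeff_ofCoeff, coeff_one, Finsupp.single_apply]
  map_mul' a b := by
    refine ext fun i => ?_
    rw [coeff_mul, coeff_ofCoeff, Finsupp.single_apply]
    split_ifs with h
    · subst h; simp [coeff_ofCoeff]
    · symm
      refine Finset.sum_eq_zero fun ij hij => ?_
      rw [Finset.HasAntidiagonal.mem_antidiagonal] at hij
      simp only [coeff_ofCoeff, Finsupp.single_apply]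
      by_cases h1 : 0 = ij.1
      · rw [if_neg (show ¬ 0 = ij.2 by omega),
          zero_pow (pow_ne_zero _ (Fact.out : p.Prime).ne_zero), mul_zero]
      · rw [if_neg h1, zero_mul]

theorem coeff_const (a : R) (i : ℕ) :
    (const K p R a).coeff i = if 0 = i then a else 0 := by
  change (ofCoeff (Finsupp.single 0 a)).coeff i = _
  rw [coeff_ofCoeff, Finsupp.single_apply]

theorem eval_const (a b : R) : (const K p R a).eval b = a * b := by
  rw [eval_eq_sum _ b 1 (fun i hi => by rw [coeff_const, if_neg (by omega)])]
  simp [coeff_const]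

theorem coeff_const_mul (a : R) (P : SkewPoly K p R) (k : ℕ) :
    (const K p R a * P).coeff k = a * P.coeff k := by
  rw [coeff_mul, Finset.sum_eq_single (0, k)]
  · simp [coeff_const]
  · rintro ⟨i, j⟩ h hne
    rw [Finset.HasAntidiagonal.mem_antidiagonal] at h
    have : ¬ 0 = i := by rintro rfl; exact hne (by simpa using h)
    simp [coeff_const, this]
  · simp

theorem coeff_mul_const (a : R) (P : SkewPoly K p R) (k : ℕ) :
    (P * const K p R a).coeff k = P.coeff k * a ^ p ^ k := by
  rw [coeff_mul, Finset.sum_eq_single (k, 0)]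
  · simp [coeff_const]
  · rintro ⟨i, j⟩ h hne
    rw [Finset.HasAntidiagonal.mem_antidiagonal] at h
    have : ¬ 0 = j := by rintro rfl; exact hne (by simpa using h)
    simp [coeff_const, this, zero_pow (pow_ne_zero _ (Fact.out : p.Prime).ne_zero)]
  · simp

end SkewPoly
end SkewRing

section Groups

set_option linter.unusedSectionVars false

variable {K : Type u} [Field K] {p : ℕ} [Fact p.Prime] [CharP K p] {n : ℕ}
variable {R : Type u} [CommRing R] [Algebra K R] {S : Type u} [CommRing S] [Algebra K S]

/-- The condition that `P = 1 + ∑_{i=1}^n λᵢ Fⁱ` with `λᵢ ^ (p ^ (n - i + 1)) = 0`. -/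
def IsInfinitesimal (n : ℕ) (P : SkewPoly K p R) : Prop :=
  P.coeff 0 = 1 ∧ (∀ i, 1 ≤ i → i ≤ n → P.coeff i ^ p ^ (n - i + 1) = 0) ∧
    ∀ i, n < i → P.coeff i = 0

theorem p_pow_ne_zero (p : ℕ) [Fact p.Prime] (i : ℕ) : p ^ i ≠ 0 :=
  pow_ne_zero _ (Fact.out : p.Prime).ne_zero

theorem isInfinitesimal_iff (P : SkewPoly K p R) : IsInfinitesimal n P ↔
    P.coeff 0 = 1 ∧ ∀ i, 1 ≤ i → P.coeff i ^ p ^ (n + 1 - i) = 0 := by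
  refine and_congr_right fun _ => ⟨fun h i hi => ?_, fun h => ⟨fun i hi hin => ?_, fun i hi => ?_⟩⟩
  · by_cases hin : i ≤ n
    · rw [show n + 1 - i = n - i + 1 by omega]; exact h.1 i hi hin
    · rw [h.2 i (by omega), zero_pow (p_pow_ne_zero p _)]
  · rw [show n - i + 1 = n + 1 - i by omega]; exact h i hi
  · have := h i (by omega)
    rwa [show n + 1 - i = 0 by omega, pow_zero, pow_one] at this

theorem pow_eq_zero_of_le_exp {a : R} {i j : ℕ} (h : a ^ p ^ i = 0) (hij : i ≤ j) :
    a ^ p ^ j = 0 :=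
  pow_eq_zero_of_le (Nat.pow_le_pow_right (Fact.out : p.Prime).pos hij) h

theorem sum_pow_p {ι : Type*} (K : Type u) [Field K] (p : ℕ) [Fact p.Prime] [CharP K p]
    {R : Type u} [CommRing R] [Algebra K R] (s : Finset ι) (f : ι → R) (i : ℕ) :
    (∑ j ∈ s, f j) ^ p ^ i = ∑ j ∈ s, f j ^ p ^ i :=
  map_sum (frob K p R i) f s

theorem IsInfinitesimal.one : IsInfinitesimal n (1 : SkewPoly K p R) := by
  rw [isInfinitesimal_iff]
  refine ⟨by simp [SkewPoly.coeff_one], fun i hi => ?_⟩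
  rw [SkewPoly.coeff_one, if_neg (by omega), zero_pow (p_pow_ne_zero p _)]

theorem IsInfinitesimal.mul {P Q : SkewPoly K p R} (hP : IsInfinitesimal n P)
    (hQ : IsInfinitesimal n Q) : IsInfinitesimal n (P * Q) := by
  rw [isInfinitesimal_iff] at *
  refine ⟨by simp [SkewPoly.coeff_mul, hP.1, hQ.1], fun k hk => ?_⟩
  rw [SkewPoly.coeff_mul, sum_pow_p K]
  refine Finset.sum_eq_zero fun ij hij => ?_
  rw [Finset.HasAntidiagonal.mem_antidiagonal] at hij
  rw [mul_pow, ← pow_mul, ← pow_add]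
  by_cases hj : ij.2 = 0
  · rw [show ij.1 = k by omega, hP.2 k hk, zero_mul]
  · rw [pow_eq_zero_of_le_exp (hQ.2 ij.2 (by omega)) (by omega), mul_zero]

theorem IsInfinitesimal.of_mul_eq_one {P Q : SkewPoly K p R} (hP : IsInfinitesimal n P)
    (h : P * Q = 1) : IsInfinitesimal n Q := by
  rw [isInfinitesimal_iff] at *
  have hc : ∀ k, ∑ ij ∈ Finset.HasAntidiagonal.antidiagonal k,
      P.coeff ij.1 * Q.coeff ij.2 ^ p ^ ij.1 = if 0 = k then 1 else 0 := fun k => by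
    rw [← SkewPoly.coeff_mul, h, SkewPoly.coeff_one]
  refine ⟨by simpa [hP.1] using hc 0, fun k hk => ?_⟩
  induction k using Nat.strong_induction_on with
  | _ k ih =>
    have h1 := congrArg (fun x : R => x ^ p ^ (n + 1 - k)) (hc k)
    beta_reduce at h1
    rw [if_neg (by omega), zero_pow (p_pow_ne_zero p _), sum_pow_p K,
      Finset.sum_eq_single (0, k)] at h1
    · simpa [hP.1] using h1
    · rintro ⟨i, j⟩ hij hne
      rw [Finset.HasAntidiagonal.mem_antidiagonal] at hij
      have hi : i ≠ 0 := by rintro rfl; exact hne (by simpa using hij)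
      rw [mul_pow, ← pow_mul, ← pow_add]
      by_cases hj : j = 0
      · rw [show i = k by simpa [hj] using hij, hP.2 k hk, zero_mul]
      · simp only at hij ⊢
        rw [pow_eq_zero_of_le_exp (ih j (by omega) (by omega)) (by omega), mul_zero]
    · intro hne
      exact absurd (by simp) hne

/-- Each `1 + ∑_{i=1}^n λᵢ Fⁱ` with `λᵢ ^ (p ^ (n - i + 1)) = 0` is invertible. -/
theorem IsInfinitesimal.isUnit {P : SkewPoly K p R} (hP : IsInfinitesimal n P) : IsUnit P := by
  rw [isInfinitesimal_iff] at hP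
  obtain ⟨N, rfl⟩ : ∃ N, P = 1 + N := ⟨P - 1, by abel⟩
  have h0 : N.coeff 0 = 0 := by
    simpa [SkewPoly.coeff_add, SkewPoly.coeff_one] using hP.1
  have hN : ∀ i, 1 ≤ i → N.coeff i ^ p ^ (n + 1 - i) = 0 := fun i hi => by
    have := hP.2 i hi
    rwa [SkewPoly.coeff_add, SkewPoly.coeff_one, if_neg (by omega), zero_add] at this
  refine IsNilpotent.isUnit_one_add ⟨n + 1, ?_⟩
  have key : ∀ m i, (i < m + 1 → (N ^ (m + 1)).coeff i = 0) ∧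
      (1 ≤ i → (N ^ (m + 1)).coeff i ^ p ^ (n + 1 - i) = 0) := by
    intro m
    induction m with
    | zero =>
      intro i
      rw [zero_add, pow_one]
      refine ⟨fun hi => ?_, hN i⟩
      obtain rfl : i = 0 := by omega
      exact h0
    | succ m ih =>
      intro k
      rw [pow_succ', SkewPoly.coeff_mul]
      refine ⟨fun hk => Finset.sum_eq_zero fun ij hij => ?_, fun hk => ?_⟩
      · rw [Finset.HasAntidiagonal.mem_antidiagonal] at hij
        by_cases hi : ij.1 = 0
        · rw [hi, h0, zero_mul]
        · rw [(ih ij.2).1 (by omega), zero_pow (p_pow_ne_zero p _), mul_zero]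
      · rw [sum_pow_p K]
        refine Finset.sum_eq_zero fun ij hij => ?_
        rw [Finset.HasAntidiagonal.mem_antidiagonal] at hij
        rw [mul_pow, ← pow_mul, ← pow_add]
        by_cases hj : ij.2 = 0
        · rw [hj, (ih 0).1 (by omega), zero_pow (p_pow_ne_zero p _), mul_zero]
        · rw [pow_eq_zero_of_le_exp ((ih ij.2).2 (by omega)) (by omega), mul_zero]
  refine SkewPoly.ext fun i => ?_
  change _ = (0 : R)
  by_cases hi : i < n + 1
  · exact (key n i).1 hi
  · have := (key n i).2 (by omega)
    rwa [show n + 1 - i = 0 by omega, pow_zero, pow_one] at this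

variable (K p n R) in
/-- The group `U_n(R) = {1 + ∑_{i=1}^n λᵢ Fⁱ | λᵢ ^ (p ^ (n - i + 1)) = 0}` inside the unit group
of the skew polynomial ring. -/
def U : Subgroup (SkewPoly K p R)ˣ where
  carrier := {P | IsInfinitesimal n (P : SkewPoly K p R)}
  one_mem' := IsInfinitesimal.one
  mul_mem' hP hQ := hP.mul hQ
  inv_mem' {P} hP := hP.of_mul_eq_one P.mul_inv

/-- The element `1 + ∑_{i=1}^n λᵢ Fⁱ` of `U_n(R)`; the entry `c i` is `λ_{i+1}`. -/
def U.mk (c : Fin n → R) (hc : ∀ i, c i ^ p ^ (n - i) = 0) : U K p n R :=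
  have h : IsInfinitesimal n (SkewPoly.ofCoeff (Finsupp.onFinset (Finset.range (n + 1))
      (fun i => if h : i = 0 then 1 else if h' : i - 1 < n then c ⟨i - 1, h'⟩ else 0) (by
        intro i hi
        rw [Finset.mem_range]
        by_contra hn
        rw [dif_neg (by omega), dif_neg (by omega)] at hi
        exact hi rfl)) : SkewPoly K p R) := by
    rw [isInfinitesimal_iff]
    refine ⟨by simp [SkewPoly.coeff_ofCoeff], fun i hi => ?_⟩
    rw [SkewPoly.coeff_ofCoeff, Finsupp.onFinset_apply, dif_neg (by omega)]
    split_ifs with h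
    · have := hc ⟨i - 1, h⟩
      rwa [show n - ((⟨i - 1, h⟩ : Fin n) : ℕ) = n + 1 - i by simp only; omega] at this
    · exact zero_pow (p_pow_ne_zero p _)
  ⟨h.isUnit.unit, h⟩

theorem U.coeff_zero (u : U K p n R) : (u.1.1 : SkewPoly K p R).coeff 0 = 1 := u.2.1

theorem U.coeff_of_lt (u : U K p n R) (i : ℕ) (hi : n < i) :
    (u.1.1 : SkewPoly K p R).coeff i = 0 := u.2.2.2 i hi

theorem U.coeff_pow (u : U K p n R) (i : Fin n) :
    (u.1.1 : SkewPoly K p R).coeff (i + 1) ^ p ^ (n - i) = 0 := by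
  have := u.2.2.1 (i + 1) (by omega) (by omega)
  rwa [show n - (↑i + 1) + 1 = n - i by omega] at this

theorem U.coeff_mk (c : Fin n → R) (hc : ∀ i, c i ^ p ^ (n - i) = 0) (i : Fin n) :
    ((U.mk (K := K) c hc).1.1 : SkewPoly K p R).coeff (i + 1) = c i := by
  refine (SkewPoly.coeff_ofCoeff _ _).trans ?_
  simp

theorem U.ext {u v : U K p n R} (h : ∀ i : Fin n, (u.1.1 : SkewPoly K p R).coeff (i + 1) =
    (v.1.1 : SkewPoly K p R).coeff (i + 1)) : u = v := by
  refine Subtype.ext (Units.ext (SkewPoly.ext fun i => ?_))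
  rcases i with _ | i
  · rw [U.coeff_zero, U.coeff_zero]
  · by_cases hi : i < n
    · exact h ⟨i, hi⟩
    · rw [U.coeff_of_lt u _ (by omega), U.coeff_of_lt v _ (by omega)]

variable (K p R) in
/-- The units of `R`, as constant units of the skew polynomial ring. -/
def constUnits : Rˣ →* (SkewPoly K p R)ˣ := Units.map (SkewPoly.const K p R)

theorem conj_mem (μ : Rˣ) (u : U K p n R) :
    constUnits K p R μ * u.1 * (constUnits K p R μ)⁻¹ ∈ U K p n R := by
  change IsInfinitesimal n (SkewPoly.const K p R (μ : R) * u.1.1 *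
    SkewPoly.const K p R ((μ⁻¹ : Rˣ) : R))
  have hu := (isInfinitesimal_iff _).1 u.2
  rw [isInfinitesimal_iff]
  simp only [SkewPoly.coeff_const_mul, SkewPoly.coeff_mul_const]
  refine ⟨by simp [hu.1], fun i hi => ?_⟩
  rw [mul_pow, mul_pow, hu.2 i hi, mul_zero, zero_mul]

variable (K p n R) in
/-- The conjugation action of `𝔾_m(R) = Rˣ` on `U_n(R)` inside the unit group of `R[F; σ]`. -/
def conjU : Rˣ →* MulAut (U K p n R) where
  toFun μ :=
    { toFun := fun u => ⟨_, conj_mem μ u⟩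
      invFun := fun u => ⟨_, conj_mem μ⁻¹ u⟩
      left_inv := fun u => Subtype.ext (by simp [mul_assoc])
      right_inv := fun u => Subtype.ext (by simp [mul_assoc])
      map_mul' := fun u v => Subtype.ext (by simp [mul_assoc]) }
  map_one' := by ext u : 2; simp
  map_mul' μ ν := by ext u : 2; simp [mul_assoc]

variable (K p n R) in
/-- The group `U_n(R) ⋊ 𝔾_m(R)`. -/
abbrev UGm : Type u := U K p n R ⋊[conjU K p n R] Rˣ

/-- The inclusion of `U_n(R) ⋊ 𝔾_m(R)` into the unit group of `R[F; σ]`. -/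
def UGm.toUnits : UGm K p n R →* (SkewPoly K p R)ˣ :=
  SemidirectProduct.lift (U K p n R).subtype (constUnits K p R) (fun _ => rfl)

variable (K p R) in
/-- The unit group of `R[F; σ]` acts on the additive group `𝔾_a(R) = R` by evaluation of additive
polynomials. -/
def evalAut : (SkewPoly K p R)ˣ →* MulAut (Multiplicative R) where
  toFun P := AddEquiv.toMultiplicative
    { toFun := SkewPoly.eval (P : SkewPoly K p R)
      invFun := SkewPoly.eval (P⁻¹.1 : SkewPoly K p R)
      left_inv := fun a => by rw [← SkewPoly.eval_mul, Units.inv_mul, SkewPoly.eval_one]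
      right_inv := fun a => by rw [← SkewPoly.eval_mul, Units.mul_inv, SkewPoly.eval_one]
      map_add' := SkewPoly.eval_add _ }
  map_one' := by
    ext a
    exact congrArg Multiplicative.ofAdd (SkewPoly.eval_one (K := K) (p := p) a.toAdd)
  map_mul' P Q := by
    ext a
    exact congrArg Multiplicative.ofAdd (SkewPoly.eval_mul P.1 Q.1 a.toAdd)

variable (K p n R) in
/-- The group `𝔾_a(R) ⋊ U_n(R) ⋊ 𝔾_m(R)` of `R`-valued points of the iterated semidirect
product. -/
abbrev Points : Type u :=
  Multiplicative R ⋊[(evalAut K p R).comp UGm.toUnits] UGm K p n R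

namespace Points

/-- The `𝔾_a`-component. -/
def alpha (g : Points K p n R) : R := g.left.toAdd

/-- The coordinate `λ_{i+1}` of the `U_n`-component. -/
def lam (g : Points K p n R) (i : Fin n) : R := (g.right.left.1.1 : SkewPoly K p R).coeff (i + 1)

/-- The `𝔾_m`-component. -/
def lam0 (g : Points K p n R) : Rˣ := g.right.right

theorem ext {g h : Points K p n R} (ha : g.alpha = h.alpha) (hl : ∀ i, g.lam i = h.lam i)
    (h0 : (g.lam0 : R) = h.lam0) : g = h :=
  SemidirectProduct.ext ha (SemidirectProduct.ext (U.ext hl) (Units.ext h0))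

/-- The action of `𝔾_a(R) ⋊ U_n(R) ⋊ 𝔾_m(R)` on `𝔸¹(R) = R`: first multiply by the element of
`Rˣ`, then apply the additive polynomial given by `U_n(R)`, then translate. -/
def act (g : Points K p n R) (a : R) : R :=
  (g.right.left.1.1 : SkewPoly K p R).eval (g.lam0 * a) + g.alpha

theorem act_eq_sum (g : Points K p n R) (a : R) : g.act a =
    g.lam0 * a + ∑ i : Fin n, g.lam i * (g.lam0 * a) ^ p ^ ((i : ℕ) + 1) + g.alpha := by
  rw [act, SkewPoly.eval_eq_sum _ _ (n + 1) (fun i hi => U.coeff_of_lt _ _ (by omega)),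
    Finset.sum_range_succ', U.coeff_zero, pow_zero, pow_one, one_mul,
    Finset.sum_range, add_comm (_ : R) ((g.lam0 : R) * a)]
  rfl

theorem act_eq_eval (g : Points K p n R) (a : R) :
    g.act a = ((UGm.toUnits g.right).1 : SkewPoly K p R).eval a + g.alpha := by
  change _ = SkewPoly.eval (g.right.left.1.1 * SkewPoly.const K p R (g.lam0 : R)) a + _
  rw [SkewPoly.eval_mul, SkewPoly.eval_const]
  rfl

theorem one_act (a : R) : (1 : Points K p n R).act a = a := by
  rw [act_eq_eval]
  change SkewPoly.eval ((UGm.toUnits (1 : UGm K p n R)).1) a + 0 = a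
  rw [map_one, add_zero]
  exact SkewPoly.eval_one a

theorem mul_act (g h : Points K p n R) (a : R) : (g * h).act a = g.act (h.act a) := by
  rw [act_eq_eval, act_eq_eval, act_eq_eval]
  change SkewPoly.eval ((UGm.toUnits (g.right * h.right)).1) a +
    (g.alpha + SkewPoly.eval (UGm.toUnits g.right).1 h.alpha) = _
  rw [map_mul, SkewPoly.eval_add]
  change SkewPoly.eval ((UGm.toUnits g.right).1 * (UGm.toUnits h.right).1) a + _ = _
  rw [SkewPoly.eval_mul]
  abel

end Points

/-- Functoriality of `U_n(R)` in `R`. -/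
def U.map (f : R →ₐ[K] S) : U K p n R →* U K p n S :=
  ((Units.map (SkewPoly.map f)).comp (U K p n R).subtype).codRestrict _ fun u => by
    change IsInfinitesimal n (SkewPoly.map f u.1.1)
    have hu := (isInfinitesimal_iff _).1 u.2
    rw [isInfinitesimal_iff]
    simp only [SkewPoly.coeff_map]
    exact ⟨by rw [hu.1, map_one], fun i hi => by rw [← map_pow, hu.2 i hi, map_zero]⟩

theorem SkewPoly.map_const (f : R →ₐ[K] S) (a : R) :
    SkewPoly.map f (SkewPoly.const K p R a) = SkewPoly.const K p S (f a) := by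
  refine SkewPoly.ext fun i => ?_
  rw [SkewPoly.coeff_map, SkewPoly.coeff_const, SkewPoly.coeff_const]
  split_ifs <;> simp

/-- Functoriality of `U_n(R) ⋊ 𝔾_m(R)` in `R`. -/
def UGm.map (f : R →ₐ[K] S) : UGm K p n R →* UGm K p n S :=
  SemidirectProduct.map (U.map f) (Units.map f) (fun μ => by
    refine MonoidHom.ext fun u => Subtype.ext (Units.ext ?_)
    change SkewPoly.map f (SkewPoly.const K p R (μ : R) * u.1.1 *
      SkewPoly.const K p R ((μ⁻¹ : Rˣ) : R)) = SkewPoly.const K p S (f μ) * SkewPoly.map f u.1.1 *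
      SkewPoly.const K p S (f ((μ⁻¹ : Rˣ) : R))
    rw [map_mul, map_mul, SkewPoly.map_const, SkewPoly.map_const])

theorem UGm.toUnits_map (f : R →ₐ[K] S) (g : UGm K p n R) :
    (UGm.toUnits (UGm.map f g)).1 = SkewPoly.map f (UGm.toUnits g).1 := by
  change SkewPoly.map f g.left.1.1 * SkewPoly.const K p S (f g.right) =
    SkewPoly.map f (g.left.1.1 * SkewPoly.const K p R (g.right : R))
  rw [map_mul, SkewPoly.map_const]

/-- Functoriality of `𝔾_a(R) ⋊ U_n(R) ⋊ 𝔾_m(R)` in `R`. -/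
def Points.map (f : R →ₐ[K] S) : Points K p n R →* Points K p n S :=
  SemidirectProduct.map (AddMonoidHom.toMultiplicative (f : R →+ S)) (UGm.map f) (fun g => by
    refine MonoidHom.ext fun a => congrArg Multiplicative.ofAdd ?_
    change f (SkewPoly.eval (UGm.toUnits g).1 a.toAdd) =
      SkewPoly.eval (UGm.toUnits (UGm.map f g)).1 (f a.toAdd)
    rw [UGm.toUnits_map, SkewPoly.eval_map])

theorem Points.alpha_map (f : R →ₐ[K] S) (g : Points K p n R) :
    (Points.map f g).alpha = f g.alpha := rfl

theorem Points.lam0_map (f : R →ₐ[K] S) (g : Points K p n R) :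
    ((Points.map f g).lam0 : S) = f g.lam0 := rfl

theorem Points.lam_map (f : R →ₐ[K] S) (g : Points K p n R) (i : Fin n) :
    (Points.map f g).lam i = f (g.lam i) := SkewPoly.coeff_map f _ _

theorem Points.act_map (f : R →ₐ[K] S) (g : Points K p n R) (a : R) :
    (Points.map f g).act (f a) = f (g.act a) := by
  simp [Points.act_eq_sum, Points.alpha_map, Points.lam0_map, Points.lam_map]

end Groups

section GroupScheme

set_option linter.unusedSectionVars false
set_option linter.unusedVariables false

variable (K : Type u) [Field K] (p : ℕ) [Fact p.Prime] [CharP K p] (n : ℕ)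

/-- The group-valued functor `R ↦ 𝔾_a(R) ⋊ U_n(R) ⋊ 𝔾_m(R)` on the category of `K`-algebras. -/
def pointsFunctor : CommAlgCat.{u} K ⥤ GrpCat.{u} where
  obj R := GrpCat.of (Points K p n R)
  map f := GrpCat.ofHom (Points.map f.hom)
  map_id R := by
    refine GrpCat.hom_ext (MonoidHom.ext fun g => Points.ext rfl (fun i => ?_) rfl)
    exact Points.lam_map _ g i
  map_comp f f' := by
    refine GrpCat.hom_ext (MonoidHom.ext fun g => Points.ext rfl (fun i => ?_) rfl)
    refine (Points.lam_map _ g i).trans ?_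
    exact ((Points.lam_map f'.hom (Points.map f.hom g) i).trans
      (congrArg f'.hom (Points.lam_map f.hom g i))).symm

/-- The coordinates `α`, `λ_1, …, λ_n`, `λ_0`, `λ_0⁻¹` on `𝔾_a ⋊ U_n ⋊ 𝔾_m`; the variable `lam i`
for `i : Fin n` stands for `λ_{i+1}`. -/
inductive Var (n : ℕ) : Type
  | alpha : Var n
  | lam : Fin n → Var n
  | lam0 : Var n
  | lam0inv : Var n

/-- The relations `λ_i ^ (p ^ (n - i + 1)) = 0` for `1 ≤ i ≤ n` and `λ_0 λ_0⁻¹ = 1`. -/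
def relations : Set (MvPolynomial (Var n) K) :=
  Set.range (fun i : Fin n => MvPolynomial.X (Var.lam i) ^ p ^ (n - i)) ∪
    {MvPolynomial.X Var.lam0 * MvPolynomial.X Var.lam0inv - 1}

/-- The coordinate ring
`K[α, λ_1, …, λ_n, λ_0, λ_0⁻¹] / (λ_1 ^ (p ^ n), λ_2 ^ (p ^ (n - 1)), …, λ_n ^ p)`. -/
def CoordRing : Type u := MvPolynomial (Var n) K ⧸ Ideal.span (relations K p n)

instance : CommRing (CoordRing K p n) :=
  inferInstanceAs (CommRing (MvPolynomial (Var n) K ⧸ Ideal.span (relations K p n)))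

instance : Algebra K (CoordRing K p n) :=
  inferInstanceAs (Algebra K (MvPolynomial (Var n) K ⧸ Ideal.span (relations K p n)))

/-- The quotient map onto the coordinate ring. -/
def CoordRing.mk : MvPolynomial (Var n) K →ₐ[K] CoordRing K p n :=
  Ideal.Quotient.mkₐ K (Ideal.span (relations K p n))

variable {K p n}
variable {R : Type u} [CommRing R] [Algebra K R]

/-- The class of a variable in the coordinate ring. -/
def CoordRing.var (v : Var n) : CoordRing K p n := CoordRing.mk K p n (MvPolynomial.X v)

theorem CoordRing.mk_eq_zero {a : MvPolynomial (Var n) K} (ha : a ∈ relations K p n) :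
    CoordRing.mk K p n a = 0 :=
  Ideal.Quotient.eq_zero_iff_mem.2 (Ideal.subset_span ha)

theorem CoordRing.lam_pow (i : Fin n) :
    (CoordRing.var (Var.lam i) : CoordRing K p n) ^ p ^ (n - i) = 0 := by
  rw [CoordRing.var, ← map_pow]
  exact CoordRing.mk_eq_zero (Or.inl ⟨i, rfl⟩)

theorem CoordRing.lam0_mul :
    (CoordRing.var Var.lam0 : CoordRing K p n) * CoordRing.var Var.lam0inv = 1 := by
  rw [CoordRing.var, CoordRing.var, ← map_mul, ← sub_eq_zero, ← map_one (CoordRing.mk K p n),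
    ← map_sub]
  exact CoordRing.mk_eq_zero (Or.inr rfl)

theorem CoordRing.algHom_ext {f g : CoordRing K p n →ₐ[K] R}
    (h : ∀ v, f (CoordRing.var v) = g (CoordRing.var v)) : f = g := by
  have h1 : f.comp (CoordRing.mk K p n) = g.comp (CoordRing.mk K p n) :=
    MvPolynomial.algHom_ext h
  refine AlgHom.ext fun a => ?_
  obtain ⟨b, rfl⟩ := Ideal.Quotient.mk_surjective a
  exact DFunLike.congr_fun h1 b

/-- The values of the coordinates at a point. -/
def Points.coord (g : Points K p n R) : Var n → R
  | .alpha => g.alpha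
  | .lam i => g.lam i
  | .lam0 => g.lam0
  | .lam0inv => ((g.lam0⁻¹ : Rˣ) : R)

/-- The algebra homomorphism attached to a point. -/
def Points.toAlgHom (g : Points K p n R) : CoordRing K p n →ₐ[K] R :=
  Ideal.Quotient.liftₐ (Ideal.span (relations K p n)) (MvPolynomial.aeval g.coord) fun a ha => by
    have hle : Ideal.span (relations K p n) ≤ RingHom.ker (MvPolynomial.aeval g.coord) := by
      rw [Ideal.span_le]
      rintro _ (⟨i, rfl⟩ | rfl)
      · rw [SetLike.mem_coe, RingHom.mem_ker, map_pow, MvPolynomial.aeval_X]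
        exact U.coeff_pow g.right.left i
      · rw [SetLike.mem_coe, RingHom.mem_ker, map_sub, map_mul, MvPolynomial.aeval_X,
          MvPolynomial.aeval_X, map_one]
        exact sub_eq_zero.2 g.lam0.mul_inv
    exact hle ha

theorem Points.toAlgHom_var (g : Points K p n R) (v : Var n) :
    g.toAlgHom (CoordRing.var v) = g.coord v :=
  MvPolynomial.aeval_X _ _

/-- The point with prescribed components `α`, `λ_1, …, λ_n` and `λ_0`. -/
def Points.mk (a : R) (c : Fin n → R) (hc : ∀ i, c i ^ p ^ (n - i) = 0) (t : Rˣ) :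
    Points K p n R :=
  ⟨Multiplicative.ofAdd a, ⟨U.mk c hc, t⟩⟩

theorem Points.alpha_mk (a : R) (c : Fin n → R) (hc : ∀ i, c i ^ p ^ (n - i) = 0) (t : Rˣ) :
    (Points.mk (K := K) a c hc t).alpha = a := rfl

theorem Points.lam_mk (a : R) (c : Fin n → R) (hc : ∀ i, c i ^ p ^ (n - i) = 0) (t : Rˣ)
    (i : Fin n) : (Points.mk (K := K) a c hc t).lam i = c i := U.coeff_mk c hc i

theorem Points.lam0_mk (a : R) (c : Fin n → R) (hc : ∀ i, c i ^ p ^ (n - i) = 0) (t : Rˣ) :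
    (Points.mk (K := K) a c hc t).lam0 = t := rfl

/-- The point attached to an algebra homomorphism on the coordinate ring. -/
def Points.ofAlgHom (f : CoordRing K p n →ₐ[K] R) : Points K p n R :=
  Points.mk (f (CoordRing.var Var.alpha)) (fun i => f (CoordRing.var (Var.lam i)))
    (fun i => by rw [← map_pow, CoordRing.lam_pow, map_zero])
    ⟨f (CoordRing.var Var.lam0), f (CoordRing.var Var.lam0inv),
      by rw [← map_mul, CoordRing.lam0_mul, map_one],
      by rw [mul_comm, ← map_mul, CoordRing.lam0_mul, map_one]⟩

theorem Points.coord_ofAlgHom (f : CoordRing K p n →ₐ[K] R) (v : Var n) :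
    (Points.ofAlgHom f).coord v = f (CoordRing.var v) := by
  cases v with
  | alpha => exact Points.alpha_mk _ _ _ _
  | lam i => exact Points.lam_mk _ _ _ _ i
  | lam0 => exact congrArg Units.val (Points.lam0_mk _ _ _ _)
  | lam0inv => exact congrArg (fun t : Rˣ => ((t⁻¹ : Rˣ) : R)) (Points.lam0_mk _ _ _ _)

theorem Points.ext_coord {g h : Points K p n R} (H : ∀ v, g.coord v = h.coord v) : g = h :=
  Points.ext (H Var.alpha) (fun i => H (Var.lam i)) (H Var.lam0)

theorem Points.coord_map {S : Type u} [CommRing S] [Algebra K S] (f : R →ₐ[K] S)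
    (g : Points K p n R) (v : Var n) : (Points.map f g).coord v = f (g.coord v) := by
  cases v with
  | alpha => rfl
  | lam i => exact Points.lam_map f g i
  | lam0 => rfl
  | lam0inv => rfl

variable (K p n R) in
/-- `R`-valued points of the spectrum of the coordinate ring are the elements of
`𝔾_a(R) ⋊ U_n(R) ⋊ 𝔾_m(R)`. -/
def algHomEquiv : (CoordRing K p n →ₐ[K] R) ≃ Points K p n R where
  toFun := Points.ofAlgHom
  invFun := Points.toAlgHom
  left_inv f := CoordRing.algHom_ext fun v => by
    rw [Points.toAlgHom_var, Points.coord_ofAlgHom]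
  right_inv g := Points.ext_coord fun v => by
    rw [Points.coord_ofAlgHom, Points.toAlgHom_var]

theorem algHomEquiv_comp {S : Type u} [CommRing S] [Algebra K S] (f : R →ₐ[K] S)
    (g : CoordRing K p n →ₐ[K] R) :
    algHomEquiv K p n S (f.comp g) = Points.map f (algHomEquiv K p n R g) :=
  Points.ext_coord fun v => by
    rw [Points.coord_map]
    exact (Points.coord_ofAlgHom _ v).trans (congrArg f (Points.coord_ofAlgHom g v)).symm

variable (K p n) in
/-- The affine `K`-scheme with coordinate ring `CoordRing K p n`, as an object of the category of
affine `K`-schemes (the opposite of the category of `K`-algebras). -/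
abbrev affG : (CommAlgCat.{u} K)ᵒᵖ := op (CommAlgCat.of K (CoordRing K p n))

variable (K p n) in
/-- `affG` represents the functor `R ↦ 𝔾_a(R) ⋊ U_n(R) ⋊ 𝔾_m(R)`. -/
def representable :
    ((unopUnop (CommAlgCat.{u} K) ⋙ pointsFunctor K p n) ⋙ forget GrpCat.{u}).RepresentableBy
      (affG K p n) where
  homEquiv {X} :=
    { toFun := fun f => algHomEquiv K p n X.unop f.unop.hom
      invFun := fun g => (CommAlgCat.ofHom ((algHomEquiv K p n X.unop).symm g)).op
      left_inv := fun f => Quiver.Hom.unop_inj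
        (CommAlgCat.hom_ext ((algHomEquiv K p n X.unop).symm_apply_apply f.unop.hom))
      right_inv := fun g => (algHomEquiv K p n X.unop).apply_symm_apply g }
  homEquiv_comp {X X'} f g := algHomEquiv_comp f.unop.hom g.unop.hom

/-- The group scheme structure on `𝔾_a ⋊ U_n ⋊ 𝔾_m`, determined by the group structures on
`𝔾_a(R) ⋊ U_n(R) ⋊ 𝔾_m(R)` via the Yoneda lemma. -/
instance : GrpObj (affG K p n) :=
  GrpObj.ofRepresentableBy _ _ (representable K p n)

open scoped MonObj in
theorem algHomEquiv_mul (X : (CommAlgCat.{u} K)ᵒᵖ) (f g : X ⟶ affG K p n) :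
    algHomEquiv K p n X.unop (f * g).unop.hom =
      algHomEquiv K p n X.unop f.unop.hom * algHomEquiv K p n X.unop g.unop.hom :=
  ((yonedaGrpObjIsoOfRepresentableBy _ _ (representable K p n)).hom.app (op X)).hom.map_mul f g

open scoped MonObj in
theorem algHomEquiv_one (X : (CommAlgCat.{u} K)ᵒᵖ) :
    algHomEquiv K p n X.unop (1 : X ⟶ affG K p n).unop.hom = 1 :=
  ((yonedaGrpObjIsoOfRepresentableBy _ _ (representable K p n)).hom.app (op X)).hom.map_one

section Line

variable (K) in
/-- The affine line `𝔸¹ = Spec K[x]`, as an object of the category of affine `K`-schemes. -/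
abbrev affLine : (CommAlgCat.{u} K)ᵒᵖ := op (CommAlgCat.of K (Polynomial K))

/-- The morphisms `X ⟶ 𝔸¹` are the elements of the coordinate ring of `X`. -/
def lineEquiv (X : (CommAlgCat.{u} K)ᵒᵖ) : (X ⟶ affLine K) ≃ X.unop where
  toFun f := f.unop.hom Polynomial.X
  invFun a := (CommAlgCat.ofHom (Polynomial.aeval a)).op
  left_inv f := Quiver.Hom.unop_inj (CommAlgCat.hom_ext (Polynomial.algHom_ext
    (Polynomial.aeval_X _)))
  right_inv a := Polynomial.aeval_X a

theorem lineEquiv_comp {X Y : (CommAlgCat.{u} K)ᵒᵖ} (f : X ⟶ Y) (g : Y ⟶ affLine K) :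
    lineEquiv X (f ≫ g) = f.unop.hom (lineEquiv Y g) := rfl

/-- The action on `X`-valued points of the affine line. -/
def actHom {X : (CommAlgCat.{u} K)ᵒᵖ} (g : X ⟶ affG K p n) (a : X ⟶ affLine K) :
    X ⟶ affLine K :=
  (lineEquiv X).symm ((algHomEquiv K p n X.unop g.unop.hom).act (lineEquiv X a))

theorem comp_actHom {X Y : (CommAlgCat.{u} K)ᵒᵖ} (f : X ⟶ Y) (g : Y ⟶ affG K p n)
    (a : Y ⟶ affLine K) : f ≫ actHom g a = actHom (f ≫ g) (f ≫ a) := by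
  apply (lineEquiv X).injective
  rw [lineEquiv_comp, actHom, actHom, Equiv.apply_symm_apply, Equiv.apply_symm_apply,
    lineEquiv_comp]
  refine (Points.act_map f.unop.hom _ _).symm.trans ?_
  exact congrArg (fun h : Points K p n X.unop => h.act _)
    (algHomEquiv_comp f.unop.hom g.unop.hom).symm

open scoped MonObj in
theorem one_actHom {X : (CommAlgCat.{u} K)ᵒᵖ} (a : X ⟶ affLine K) :
    actHom (1 : X ⟶ affG K p n) a = a := by
  rw [actHom, algHomEquiv_one, Points.one_act, Equiv.symm_apply_apply]

open scoped MonObj in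
theorem mul_actHom {X : (CommAlgCat.{u} K)ᵒᵖ} (g h : X ⟶ affG K p n) (a : X ⟶ affLine K) :
    actHom (g * h) a = actHom g (actHom h a) := by
  rw [actHom, algHomEquiv_mul, Points.mul_act, actHom, actHom, Equiv.apply_symm_apply]

end Line

/-- A natural action of the groups of `X`-valued points defines an action of a group object. -/
@[reducible] def modObjOfNatural {C : Type*} [Category C] [CartesianMonoidalCategory C]
    {M Y : C} [MonObj M] (act : ∀ {X : C}, (X ⟶ M) → (X ⟶ Y) → (X ⟶ Y))
    (nat : ∀ {X X' : C} (f : X ⟶ X') (g : X' ⟶ M) (a : X' ⟶ Y),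
      f ≫ act g a = act (f ≫ g) (f ≫ a))
    (one : ∀ {X : C} (a : X ⟶ Y), act (toUnit X ≫ MonObj.one) a = a)
    (mul : ∀ {X : C} (g h : X ⟶ M) (a : X ⟶ Y),
      act (lift g h ≫ MonObj.mul) a = act g (act h a)) : ModObj M Y where
  smul := act (fst M Y) (snd M Y)
  one_smul := by
    change MonObj.one ▷ Y ≫ act (fst M Y) (snd M Y) = (λ_ Y).hom
    rw [nat, whiskerRight_fst, whiskerRight_snd, leftUnitor_hom,
      toUnit_unique (fst (𝟙_ C) Y) (toUnit _), one]
  mul_smul := by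
    change MonObj.mul ▷ Y ≫ act (fst M Y) (snd M Y) =
      (α_ M M Y).hom ≫ M ◁ act (fst M Y) (snd M Y) ≫ act (fst M Y) (snd M Y)
    rw [nat, nat, nat, whiskerRight_fst, whiskerRight_snd, whiskerLeft_fst, whiskerLeft_snd,
      associator_hom_fst, nat, nat, associator_hom_snd_fst, associator_hom_snd_snd, ← mul]
    congr 2
    ext <;> simp

/-- The action of `𝔾_a ⋊ U_n ⋊ 𝔾_m` on the affine line. -/
instance : ModObj (affG K p n) (affLine K) :=
  modObjOfNatural actHom comp_actHom one_actHom mul_actHom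

/-- Monoidal functors preserve actions of monoid objects. -/
@[reducible] def modObjObj {C D : Type*} [Category C] [Category D] [MonoidalCategory C]
    [MonoidalCategory D] (F : C ⥤ D) [F.Monoidal] (M Y : C) [MonObj M] [ModObj M Y] :
    letI := F.monObjObj M
    ModObj (F.obj M) (F.obj Y) :=
  letI := F.monObjObj M
  { smul := Functor.LaxMonoidal.μ F M Y ≫ F.map (ModObj.smul (M := M) (X := Y))
    one_smul := by
      have h : MonObj.one ▷ Y ≫ ModObj.smul (M := M) (X := Y) = (λ_ Y).hom :=
        ModObj.one_smul (C := C) (D := C) (M := M) Y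
      change (Functor.LaxMonoidal.ε F ≫ F.map MonObj.one) ▷ F.obj Y ≫
        Functor.LaxMonoidal.μ F M Y ≫ F.map (ModObj.smul (M := M) (X := Y)) = (λ_ (F.obj Y)).hom
      simp [← F.map_comp, h]
    mul_smul := by
      have h : MonObj.mul ▷ Y ≫ ModObj.smul (M := M) (X := Y) = (α_ M M Y).hom ≫
        M ◁ ModObj.smul (M := M) (X := Y) ≫ ModObj.smul (M := M) (X := Y) :=
          ModObj.mul_smul (C := C) (D := C) (M := M) Y
      change (Functor.LaxMonoidal.μ F M M ≫ F.map MonObj.mul) ▷ F.obj Y ≫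
        Functor.LaxMonoidal.μ F M Y ≫ F.map (ModObj.smul (M := M) (X := Y)) =
        (α_ _ _ _).hom ≫ F.obj M ◁ (Functor.LaxMonoidal.μ F M Y ≫
          F.map (ModObj.smul (M := M) (X := Y))) ≫ Functor.LaxMonoidal.μ F M Y ≫
            F.map (ModObj.smul (M := M) (X := Y))
      simp_rw [comp_whiskerRight, Category.assoc, Functor.LaxMonoidal.μ_natural_left_assoc,
        MonoidalCategory.whiskerLeft_comp, Category.assoc,
        Functor.LaxMonoidal.μ_natural_right_assoc]
      slice_lhs 3 4 => rw [← F.map_comp, h]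
      simp }
end GroupScheme

section Compactification

set_option linter.unusedSectionVars false

variable (K : Type u) [Field K] (p : ℕ) [Fact p.Prime] (n : ℕ)

/-- The numerical semigroup `Γ_{p,n} = ⟨p ^ n, p ^ n - p ^ j (0 ≤ j < n)⟩`. -/
def semigroup (p n : ℕ) : AddSubmonoid ℕ :=
  AddSubmonoid.closure ({p ^ n} ∪ {m | ∃ j < n, m = p ^ n - p ^ j})

/-- The semigroup ring `K[T^Γ]` for `Γ = Γ_{p,n}`. -/
abbrev SemigroupRing : Type u := AddMonoidAlgebra K (semigroup p n)

/-- The inclusion of `K[T^Γ]` into the Laurent polynomial ring `K[T, T⁻¹]`. -/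
def semigroupToLaurent : SemigroupRing K p n →ₐ[K] LaurentPolynomial K :=
  AddMonoidAlgebra.mapDomainAlgHom K K ((Nat.castAddMonoidHom ℤ).comp (semigroup p n).subtype)

/-- The inclusion of `K[x] = K[T⁻¹]` into `K[T, T⁻¹]`, that is, `x ↦ T⁻¹`. -/
def lineToLaurent : Polynomial K →ₐ[K] LaurentPolynomial K :=
  Polynomial.aeval (LaurentPolynomial.T (-1))

/-- The morphism `Spec K[T, T⁻¹] ⟶ Spec K[T^Γ]`. -/
def overlapToSemigroup : Spec (.of (LaurentPolynomial K)) ⟶ Spec (.of (SemigroupRing K p n)) :=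
  Spec.map (CommRingCat.ofHom (semigroupToLaurent K p n).toRingHom)

/-- The morphism `Spec K[T, T⁻¹] ⟶ Spec K[T⁻¹]`. -/
def overlapToLine : Spec (.of (LaurentPolynomial K)) ⟶ Spec (.of (Polynomial K)) :=
  Spec.map (CommRingCat.ofHom (lineToLaurent K).toRingHom)

/-- A ring inclusion which is the localization at one element defines an open immersion. -/
theorem isOpenImmersion_of_away {A B : Type u} [CommRing A] [CommRing B] (f : A →+* B) (s : A)
    (hs : IsUnit (f s)) (hinj : Function.Injective f)
    (hsurj : ∀ b, ∃ (k : ℕ) (a : A), b * f s ^ k = f a) :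
    IsOpenImmersion (Spec.map (CommRingCat.ofHom f)) := by
  let _ := f.toAlgebra
  have : IsLocalization.Away s B :=
    IsLocalization.Away.mk s hs hsurj fun a b h => ⟨0, by rw [hinj h]⟩
  exact IsOpenImmersion.of_isLocalization (S := B) s

theorem semigroupToLaurent_single (m : semigroup p n) (a : K) :
    semigroupToLaurent K p n (AddMonoidAlgebra.single m a) =
      LaurentPolynomial.C a * LaurentPolynomial.T ((m : ℕ) : ℤ) := by
  rw [← LaurentPolynomial.single_eq_C_mul_T]
  exact AddMonoidAlgebra.mapDomain_single

theorem pow_mem_semigroup : p ^ n ∈ semigroup p n :=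
  AddSubmonoid.subset_closure (Or.inl rfl)

theorem pow_sub_one_mem_semigroup : p ^ n - 1 ∈ semigroup p n := by
  rcases Nat.eq_zero_or_pos n with rfl | hn
  · simp
  · exact AddSubmonoid.subset_closure (Or.inr ⟨0, hn, by simp⟩)

/-- Every integer becomes an element of `Γ_{p,n}` after adding a multiple of `p ^ n`. -/
theorem exists_add_mem_semigroup (m : ℤ) :
    ∃ (k : ℕ) (l : semigroup p n), m + k * (p ^ n : ℕ) = ((l : ℕ) : ℤ) := by
  obtain ⟨q, hq⟩ : ∃ q, p ^ n = q + 1 :=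
    ⟨p ^ n - 1, (Nat.sub_add_cancel (pow_pos (Fact.out : p.Prime).pos n)).symm⟩
  have h1 := pow_mem_semigroup p n
  have h2 := pow_sub_one_mem_semigroup p n
  rw [hq] at h1 h2 ⊢
  rw [Nat.add_sub_cancel] at h2
  obtain ⟨a, rfl | rfl⟩ := m.eq_nat_or_neg
  · refine ⟨a * q + a, ⟨a * q * q + 2 * a * (q + 1), ?_⟩, ?_⟩
    · refine add_mem ?_ ?_
      · simpa using nsmul_mem h2 (a * q)
      · simpa using nsmul_mem h1 (2 * a)
    · push_cast
      ring
  · refine ⟨a, ⟨a * q, by simpa using nsmul_mem h2 a⟩, ?_⟩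
    push_cast
    ring

theorem semigroupToLaurent_injective : Function.Injective (semigroupToLaurent K p n) :=
  AddMonoidAlgebra.mapDomain_injective (Nat.cast_injective.comp Subtype.val_injective)

theorem lineToLaurent_eq (f : Polynomial K) :
    lineToLaurent K f = LaurentPolynomial.invert (Polynomial.toLaurent f) := by
  have : lineToLaurent K =
      (LaurentPolynomial.invert (R := K)).toAlgHom.comp Polynomial.toLaurentAlg :=
    Polynomial.algHom_ext (by simp [lineToLaurent])
  exact DFunLike.congr_fun this f

/-- `Spec K[T, T⁻¹]` is an open subscheme of `Spec K[T^Γ]`. -/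
instance isOpenImmersion_semigroup :
    IsOpenImmersion (overlapToSemigroup K p n) := by
  have hs : semigroupToLaurent K p n (AddMonoidAlgebra.single ⟨p ^ n, pow_mem_semigroup p n⟩ 1) =
      LaurentPolynomial.T ((p ^ n : ℕ) : ℤ) := by
    rw [semigroupToLaurent_single, map_one, one_mul]
  refine isOpenImmersion_of_away _ (AddMonoidAlgebra.single ⟨p ^ n, pow_mem_semigroup p n⟩ 1)
    ?_ (semigroupToLaurent_injective K p n) fun b => ?_
  · change IsUnit (semigroupToLaurent K p n _)
    rw [hs]
    exact LaurentPolynomial.isUnit_T _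
  · change ∃ k a, b * semigroupToLaurent K p n _ ^ k = semigroupToLaurent K p n a
    rw [hs]
    simp only [LaurentPolynomial.T_pow]
    induction b using LaurentPolynomial.induction_on' with
    | add b c hb hc =>
      obtain ⟨k, x, hx⟩ := hb
      obtain ⟨l, y, hy⟩ := hc
      refine ⟨k + l, x * AddMonoidAlgebra.single ⟨p ^ n, pow_mem_semigroup p n⟩ 1 ^ l +
        y * AddMonoidAlgebra.single ⟨p ^ n, pow_mem_semigroup p n⟩ 1 ^ k, ?_⟩
      rw [map_add, map_mul, map_mul, map_pow, map_pow, hs, ← hx, ← hy, LaurentPolynomial.T_pow,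
        LaurentPolynomial.T_pow, Nat.cast_add, add_mul _ _ ((p ^ n : ℕ) : ℤ), LaurentPolynomial.T_add]
      ring
    | C_mul_T m a =>
      obtain ⟨k, l, h⟩ := exists_add_mem_semigroup p n m
      refine ⟨k, AddMonoidAlgebra.single l a, ?_⟩
      rw [semigroupToLaurent_single, mul_assoc, ← LaurentPolynomial.T_add, h]

/-- `Spec K[T, T⁻¹]` is an open subscheme of `𝔸¹ = Spec K[T⁻¹]`. -/
instance isOpenImmersion_line :
    IsOpenImmersion (overlapToLine K) := by
  refine isOpenImmersion_of_away _ Polynomial.X ?_ ?_ fun b => ?_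
  · change IsUnit (lineToLaurent K Polynomial.X)
    rw [lineToLaurent, Polynomial.aeval_X]
    exact LaurentPolynomial.isUnit_T _
  · intro f g h
    have h' : lineToLaurent K f = lineToLaurent K g := h
    rw [lineToLaurent_eq, lineToLaurent_eq] at h'
    exact Polynomial.toLaurent_injective (LaurentPolynomial.invert.injective h')
  · change ∃ k a, b * lineToLaurent K Polynomial.X ^ k = lineToLaurent K a
    obtain ⟨k, a, h⟩ := LaurentPolynomial.exists_T_pow (LaurentPolynomial.invert b)
    refine ⟨k, a, ?_⟩
    rw [lineToLaurent_eq K a, h, map_mul, LaurentPolynomial.involutive_invert, lineToLaurent,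
      Polynomial.aeval_X, LaurentPolynomial.T_pow, LaurentPolynomial.invert_T]
    simp

/-- The scheme `X_{p,n} = Spec K[T^Γ] ∪ Spec K[T⁻¹]`, glued along `Spec K[T, T⁻¹]`. -/
def compactificationScheme : Scheme.{u} :=
  pushout (overlapToSemigroup K p n) (overlapToLine K)

/-- The inclusion `Spec K[T^Γ] ⊆ X_{p,n}`. -/
def semigroupChart : Spec (.of (SemigroupRing K p n)) ⟶ compactificationScheme K p n :=
  pushout.inl (overlapToSemigroup K p n) (overlapToLine K)

/-- The inclusion `𝔸¹ = Spec K[T⁻¹] ⊆ X_{p,n}`. -/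
def lineChart : Spec (.of (Polynomial K)) ⟶ compactificationScheme K p n :=
  pushout.inr (overlapToSemigroup K p n) (overlapToLine K)

instance : IsOpenImmersion (semigroupChart K p n) :=
  inferInstanceAs (IsOpenImmersion
    (colimit.ι (span (overlapToSemigroup K p n) (overlapToLine K)) WalkingSpan.left))

instance : IsOpenImmersion (lineChart K p n) :=
  inferInstanceAs (IsOpenImmersion
    (colimit.ι (span (overlapToSemigroup K p n) (overlapToLine K)) WalkingSpan.right))

/-- The structure morphism of `X_{p,n}` over `Spec K`. -/
def compactificationStructure : compactificationScheme K p n ⟶ Spec (.of K) :=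
  pushout.desc (Spec.map (CommRingCat.ofHom (algebraMap K (SemigroupRing K p n))))
    (Spec.map (CommRingCat.ofHom (algebraMap K (Polynomial K)))) (by
      rw [overlapToSemigroup, overlapToLine, ← Spec.map_comp, ← Spec.map_comp, ← CommRingCat.ofHom_comp, ← CommRingCat.ofHom_comp]
      exact congrArg (fun f => Spec.map (CommRingCat.ofHom f))
        ((semigroupToLaurent K p n).comp_algebraMap.trans (lineToLaurent K).comp_algebraMap.symm))

/-- The compactification `X_{p,n}` of the affine line as a `K`-scheme. -/
def X : Over (Spec (.of K)) := Over.mk (compactificationStructure K p n)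

theorem lineChart_structure : lineChart K p n ≫ compactificationStructure K p n =
    Spec.map (CommRingCat.ofHom (algebraMap K (Polynomial K))) :=
  pushout.inr_desc _ _ _

variable [CharP K p]

/-- The embedding of affine `K`-schemes into `K`-schemes. -/
def toScheme : (CommAlgCat.{u} K)ᵒᵖ ⥤ Over (Spec (.of K)) := algSpec (.of K)

instance : (toScheme K).Monoidal := (braidedAlgSpec (R := .of K)).toMonoidal

/-- The group scheme `𝔾_a ⋊ U_n ⋊ 𝔾_m` over `K`. -/
def G : Over (Spec (.of K)) := (toScheme K).obj (affG K p n)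

/-- The affine line `𝔸¹ = Spec K[T⁻¹]` over `K`, with coordinate `x = T⁻¹`. -/
def A1 : Over (Spec (.of K)) := (toScheme K).obj (affLine K)

instance : GrpObj (G K p n) := Functor.grpObjObj (F := toScheme K) (G := affG K p n)

instance : ModObj (G K p n) (A1 K) :=
  modObjObj (toScheme K) (affG K p n) (affLine K)

/-- The open immersion `𝔸¹ = Spec K[T⁻¹] ⊆ X_{p,n}`. -/
def ι : A1 K ⟶ X K p n :=
  Over.homMk (lineChart K p n) (lineChart_structure K p n)

instance : IsOpenImmersion (ι K p n).left := inferInstanceAs (IsOpenImmersion (lineChart K p n))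

end Compactification

end

end SkewAction

/-! Write `x = T⁻¹` and let a point `g` act by `x ↦ gx = ∑ lᵢ x ^ pⁱ + α`, where `l₀ = λ₀` and `lᵢ =
λᵢ λ₀ ^ pⁱ` for `i ≥ 1`. The nilpotency conditions on the `λᵢ` say exactly that raising to the power
`p ^ j` kills every `lᵢ` with `i ≥ 1` and `i + j > n`. Hence `(gx) ^ p ^ j` has degree at most `p ^
n` in `x`, and multiplying by `T ^ p ^ n` gives `N_j = ∑ lᵢ ^ p ^ j T ^ (p ^ n - p ^ (i + j)) + α ^
p ^ j T ^ p ^ n`, summed over `i ≤ n - j`, which involves only generators of `Γ`. For `j = n` this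
is `D = λ₀ ^ p ^ n + α ^ p ^ n T ^ p ^ n`, a unit where `T ^ p ^ n` vanishes. So near infinity `g`
acts by `T ^ p ^ n ↦ T ^ p ^ n / D` and `T ^ (p ^ n - p ^ j) ↦ N_j / D`.

The argument is carried out on points with values in `K`-algebras. A point of `Spec K[T^Γ]` is a
character of the monoid `Γ`, and `Points.IsTransform` records the formulas above. That the formulas
respect the relations of `Γ` (`Points.exists_isTransform`) is checked in `R[T^Γ] ⊆ R[T, T⁻¹]`, where
they describe powers of the single element `gx`. The multiplicativity of transforms is the cocycle
identity `Points.IsTransform.numer_mul`.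

The two chartwise actions agree where the charts meet (`ActRel.unique`) and are defined locally on
`G × X`, so they glue (`exists_hom_of_rel`, `exists_actMor`). The action laws are then checked
locally. This works because the transform of a character vanishing at `T ^ p ^ n` again vanishes
there, so that a second group element can be applied after shrinking. -/

namespace SkewAction

noncomputable section

/-! ### Generators and characters of the monoid `Γ_{p,n}`. -/

section SemigroupGenerators

set_option linter.unusedSectionVars false

variable (p n : ℕ) [Fact p.Prime]

/-- The element `p ^ n` of `Γ_{p,n}`. -/
def topGen : semigroup p n := ⟨p ^ n, pow_mem_semigroup p n⟩

/-- The element `p ^ n - p ^ j` of `Γ_{p,n}`, which is zero for `n ≤ j`. -/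
def gapGen (j : ℕ) : semigroup p n := ⟨p ^ n - p ^ j, by
  by_cases h : j < n
  · exact AddSubmonoid.subset_closure (Or.inr ⟨j, h, rfl⟩)
  · rw [Nat.sub_eq_zero_of_le (Nat.pow_le_pow_right (Fact.out : p.Prime).pos (by omega))]
    exact zero_mem _⟩

variable {p n}

theorem gapGen_self : gapGen p n n = 0 := Subtype.ext (Nat.sub_self _)

theorem semigroup_induction {motive : semigroup p n → Prop} (top : motive (topGen p n))
    (gap : ∀ j < n, motive (gapGen p n j)) (zero : motive 0)
    (add : ∀ a b, motive a → motive b → motive (a + b)) (a : semigroup p n) : motive a := by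
  obtain ⟨a, ha⟩ := a
  induction ha using AddSubmonoid.closure_induction with
  | mem x hx =>
    rcases hx with rfl | ⟨j, hj, rfl⟩
    · exact top
    · exact gap j hj
  | zero => exact zero
  | add x y hx hy ihx ihy => exact add _ _ ihx ihy

/-- A character of `Γ_{p,n}` is determined by its values on the generators. -/
theorem character_ext {R : Type*} [CommMonoid R] {χ ψ : Multiplicative (semigroup p n) →* R}
    (top : χ (.ofAdd (topGen p n)) = ψ (.ofAdd (topGen p n)))
    (gap : ∀ j < n, χ (.ofAdd (gapGen p n j)) = ψ (.ofAdd (gapGen p n j))) : χ = ψ := by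
  refine MonoidHom.ext fun a => ?_
  refine semigroup_induction (motive := fun a => χ (.ofAdd a) = ψ (.ofAdd a)) top gap ?_ ?_ a.toAdd
  · rw [ofAdd_zero, map_one, map_one]
  · intro a b ha hb
    rw [ofAdd_add, map_mul, map_mul, ha, hb]

variable (p n) in
/-- The character `γ ↦ t ^ γ` of `Γ_{p,n}`. -/
def powChar {R : Type*} [CommMonoid R] (t : R) : Multiplicative (semigroup p n) →* R where
  toFun a := t ^ (a.toAdd : ℕ)
  map_one' := pow_zero t
  map_mul' _ _ := pow_add t _ _

theorem powChar_ofAdd {R : Type*} [CommMonoid R] (t : R) (a : semigroup p n) :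
    powChar p n t (.ofAdd a) = t ^ (a : ℕ) := rfl

end SemigroupGenerators

/-! ### The action near infinity, as fractions on characters of `Γ_{p,n}`. -/

section Transform

set_option linter.unusedSectionVars false

variable {K : Type u} [Field K] {p : ℕ} [Fact p.Prime] [CharP K p] {n : ℕ}
variable {R : Type u} [CommRing R] [Algebra K R] {S : Type u} [CommRing S] [Algebra K S]

namespace Points

/-- The coefficient of `F ^ i` in the skew polynomial by which a point acts. -/
def linCoeff (g : Points K p n R) (i : ℕ) : R :=
  ((UGm.toUnits g.right).1 : SkewPoly K p R).coeff i

theorem linCoeff_eq (g : Points K p n R) (i : ℕ) :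
    g.linCoeff i = (g.right.left.1.1 : SkewPoly K p R).coeff i * (g.lam0 : R) ^ p ^ i :=
  SkewPoly.coeff_mul_const _ _ _

theorem linCoeff_zero (g : Points K p n R) : g.linCoeff 0 = g.lam0 := by
  rw [linCoeff_eq, U.coeff_zero, one_mul, pow_zero, pow_one]

/-- This is the only form in which the infinitesimality of `U_n` enters: `λᵢ` dies at exponent `p ^
(n + 1 - i)`, and `n < i + j` makes `p ^ j` at least that large. -/
theorem linCoeff_pow (g : Points K p n R) {i j : ℕ} (hi : i ≠ 0) (hij : n < i + j) :
    g.linCoeff i ^ p ^ j = 0 := by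
  have h := ((isInfinitesimal_iff _).1 g.right.left.2).2 i (by omega)
  rw [linCoeff_eq, mul_pow, pow_eq_zero_of_le_exp h (by omega), zero_mul]

theorem linCoeff_of_lt (g : Points K p n R) {i : ℕ} (hi : n < i) : g.linCoeff i = 0 := by
  simpa using g.linCoeff_pow (i := i) (j := 0) (by omega) (by omega)

theorem linCoeff_one (i : ℕ) : (1 : Points K p n R).linCoeff i = if 0 = i then 1 else 0 := by
  rw [linCoeff, SemidirectProduct.one_right, map_one]
  exact SkewPoly.coeff_one i

theorem linCoeff_mul (g h : Points K p n R) (k : ℕ) : (g * h).linCoeff k =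
    ∑ ij ∈ Finset.HasAntidiagonal.antidiagonal k, g.linCoeff ij.1 * h.linCoeff ij.2 ^ p ^ ij.1 := by
  rw [linCoeff, SemidirectProduct.mul_right, map_mul]
  exact SkewPoly.coeff_mul _ _ k

theorem linCoeff_map (f : R →ₐ[K] S) (g : Points K p n R) (i : ℕ) :
    (Points.map f g).linCoeff i = f (g.linCoeff i) := by
  change SkewPoly.coeff (UGm.toUnits (UGm.map f g.right)).1 i = _
  rw [UGm.toUnits_map]
  exact SkewPoly.coeff_map f _ i

theorem act_eq_sum_linCoeff (g : Points K p n R) (a : R) :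
    g.act a = ∑ i ∈ Finset.range (n + 1), g.linCoeff i * a ^ p ^ i + g.alpha := by
  rw [act_eq_eval, SkewPoly.eval_eq_sum _ _ (n + 1) fun i hi => g.linCoeff_of_lt (by omega)]
  rfl

theorem alpha_one : (1 : Points K p n R).alpha = 0 := rfl

theorem alpha_mul (g h : Points K p n R) : (g * h).alpha = g.act h.alpha := by
  rw [act_eq_eval, add_comm]
  rfl

/-- Frobenius is additive, and the terms with `i + j > n` vanish by `linCoeff_pow`. The resulting
bound `p ^ n` on the degree in `a`, for every `j ≤ n`, is what makes the action extend to infinity.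
-/
theorem act_pow (g : Points K p n R) (a : R) {j : ℕ} (hj : j ≤ n) : g.act a ^ p ^ j =
    ∑ i ∈ Finset.range (n + 1 - j), g.linCoeff i ^ p ^ j * a ^ p ^ (i + j) + g.alpha ^ p ^ j := by
  rw [act_eq_sum_linCoeff, add_pow_p K, sum_pow_p K]
  congr 1
  rw [← Finset.sum_subset (Finset.range_mono (Nat.sub_le (n + 1) j))]
  · refine Finset.sum_congr rfl fun i _ => ?_
    rw [mul_pow, ← pow_mul, ← pow_add]
  · intro i hi hi'
    -- An omitted index has `i ≥ n + 1 - j ≥ 1`, so the invertible coefficient `l₀` is never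
    -- discarded.
    rw [Finset.mem_range] at hi hi'
    rw [mul_pow, g.linCoeff_pow (by omega) (by omega), zero_mul]

/-- The numerator of the transform of `T ^ (p ^ n - p ^ j)` under a point. -/
def numer (g : Points K p n R) (χ : Multiplicative (semigroup p n) →* R) (j : ℕ) : R :=
  ∑ i ∈ Finset.range (n + 1 - j), g.linCoeff i ^ p ^ j * χ (.ofAdd (gapGen p n (i + j))) +
    g.alpha ^ p ^ j * χ (.ofAdd (topGen p n))

/-- The common denominator of the transforms of the generators of `K[T^Γ]` under a point. -/
def denom (g : Points K p n R) (χ : Multiplicative (semigroup p n) →* R) : R := g.numer χ n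

/-- For `j = n` only the term `i = 0` survives. In this form the denominator is visibly a unit
wherever `χ` vanishes at `p ^ n`. -/
theorem denom_eq (g : Points K p n R) (χ : Multiplicative (semigroup p n) →* R) :
    g.denom χ = (g.lam0 : R) ^ p ^ n + g.alpha ^ p ^ n * χ (.ofAdd (topGen p n)) := by
  rw [denom, numer, Nat.add_sub_cancel_left, Finset.sum_range_one, zero_add, gapGen_self,
    ofAdd_zero, map_one, mul_one, linCoeff_zero]

/-- The character `ψ` is the image of the character `χ` under the point `g`. -/
structure IsTransform (g : Points K p n R) (χ ψ : Multiplicative (semigroup p n) →* R) :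
    Prop where
  isUnit : IsUnit (g.denom χ)
  top : ψ (.ofAdd (topGen p n)) * g.denom χ = χ (.ofAdd (topGen p n))
  gap : ∀ j ≤ n, ψ (.ofAdd (gapGen p n j)) * g.denom χ = g.numer χ j

theorem numer_map (f : R →ₐ[K] S) (g : Points K p n R)
    (χ : Multiplicative (semigroup p n) →* R) (j : ℕ) :
    (Points.map f g).numer ((f : R →* S).comp χ) j = f (g.numer χ j) := by
  simp [numer, linCoeff_map, alpha_map]

theorem denom_map (f : R →ₐ[K] S) (g : Points K p n R)
    (χ : Multiplicative (semigroup p n) →* R) :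
    (Points.map f g).denom ((f : R →* S).comp χ) = f (g.denom χ) := numer_map f g χ n

theorem IsTransform.map (f : R →ₐ[K] S) {g : Points K p n R}
    {χ ψ : Multiplicative (semigroup p n) →* R} (h : g.IsTransform χ ψ) :
    (Points.map f g).IsTransform ((f : R →* S).comp χ) ((f : R →* S).comp ψ) where
  isUnit := by rw [denom_map]; exact h.isUnit.map f
  top := by
    rw [denom_map]
    exact (map_mul f _ _).symm.trans (congrArg f h.top)
  gap j hj := by
    rw [denom_map, numer_map]
    exact (map_mul f _ _).symm.trans (congrArg f (h.gap j hj))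

/-- The denominator is a unit, so the defining equations fix the values on generators. -/
theorem IsTransform.unique {g : Points K p n R} {χ ψ ψ' : Multiplicative (semigroup p n) →* R}
    (h : g.IsTransform χ ψ) (h' : g.IsTransform χ ψ') : ψ = ψ' :=
  character_ext (h.isUnit.mul_right_cancel (h.top.trans h'.top.symm)) fun j hj =>
    h.isUnit.mul_right_cancel ((h.gap j hj.le).trans (h'.gap j hj.le).symm)

theorem numer_one (χ : Multiplicative (semigroup p n) →* R) {j : ℕ} (hj : j ≤ n) :
    (1 : Points K p n R).numer χ j = χ (.ofAdd (gapGen p n j)) := by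
  rw [numer, alpha_one, zero_pow (p_pow_ne_zero p j), zero_mul, add_zero,
    Finset.sum_eq_single 0]
  · simp [linCoeff_one]
  · intro i _ hi
    rw [linCoeff_one, if_neg (Ne.symm hi), zero_pow (p_pow_ne_zero p j), zero_mul]
  · intro h
    exact absurd (Finset.mem_range.2 (by omega)) h

theorem denom_one (χ : Multiplicative (semigroup p n) →* R) :
    (1 : Points K p n R).denom χ = 1 := by
  rw [denom, numer_one χ le_rfl, gapGen_self, ofAdd_zero, map_one]

theorem isTransform_one (χ : Multiplicative (semigroup p n) →* R) :
    (1 : Points K p n R).IsTransform χ χ where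
  isUnit := by rw [denom_one]; exact isUnit_one
  top := by rw [denom_one, mul_one]
  gap j hj := by rw [denom_one, mul_one, numer_one χ hj]

/-- The cocycle identity behind multiplicativity of the action. Since `χ` need not consist of powers
of a unit, it cannot be read off from `(gh)x = g(hx)`; it is verified by expanding both sides and
comparing with the multiplication rule for skew polynomials. -/
theorem IsTransform.numer_mul {h : Points K p n R} {χ ψ : Multiplicative (semigroup p n) →* R}
    (H : h.IsTransform χ ψ) (g : Points K p n R) {j : ℕ} (hj : j ≤ n) :
    (g * h).numer χ j = g.numer ψ j * h.denom χ := by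
  -- Multiplication by the denominator of `h` turns each value of `ψ` at a gap generator into a
  -- numerator of `h`, which splits into a linear part and a translation part.
  have key : ∀ i ∈ Finset.range (n + 1 - j),
      g.linCoeff i ^ p ^ j * ψ (.ofAdd (gapGen p n (i + j))) * h.denom χ =
      ∑ k ∈ Finset.range (n + 1 - j - i), g.linCoeff i ^ p ^ j *
        (h.linCoeff k ^ p ^ (i + j) * χ (.ofAdd (gapGen p n (k + (i + j))))) +
      g.linCoeff i ^ p ^ j * h.alpha ^ p ^ (i + j) * χ (.ofAdd (topGen p n)) := by
    intro i hi
    rw [Finset.mem_range] at hi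
    rw [mul_assoc, H.gap (i + j) (by omega), numer, mul_add, Finset.mul_sum,
      show n + 1 - (i + j) = n + 1 - j - i by omega]
    ring
  rw [numer, numer, add_mul, Finset.sum_mul, Finset.sum_congr rfl key, Finset.sum_add_distrib,
    mul_assoc, H.top, alpha_mul, act_pow _ _ hj, ← Finset.sum_mul, add_mul, ← add_assoc]
  -- The translation parts match through `(gh).alpha = g.act h.alpha`. The linear parts remain: a
  -- sum over `(m, i, k)` with `i + k = m` against a sum over `(i, k)`.
  congr 2
  simp only [linCoeff_mul, sum_pow_p K, Finset.sum_mul]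
  rw [Finset.sum_sigma', Finset.sum_sigma']
  refine Finset.sum_bij' (fun x _ => ⟨x.2.1, x.2.2⟩) (fun x _ => ⟨x.1 + x.2, (x.1, x.2)⟩)
    ?_ ?_ ?_ ?_ ?_
  · rintro ⟨m, i, k⟩ hx
    simp only [Finset.mem_sigma, Finset.mem_range, Finset.HasAntidiagonal.mem_antidiagonal] at hx ⊢
    obtain ⟨_, rfl⟩ := hx
    exact ⟨by omega, by omega⟩
  · rintro ⟨i, k⟩ hx
    simp only [Finset.mem_sigma, Finset.mem_range, Finset.HasAntidiagonal.mem_antidiagonal] at hx ⊢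
    exact ⟨by omega, trivial⟩
  · rintro ⟨m, i, k⟩ hx
    simp only [Finset.mem_sigma, Finset.mem_range, Finset.HasAntidiagonal.mem_antidiagonal] at hx
    obtain ⟨_, rfl⟩ := hx
    rfl
  · rintro ⟨i, k⟩ _
    rfl
  · rintro ⟨m, i, k⟩ hx
    simp only [Finset.mem_sigma, Finset.mem_range, Finset.HasAntidiagonal.mem_antidiagonal] at hx
    obtain ⟨_, rfl⟩ := hx
    rw [mul_pow, ← pow_mul, ← pow_add, mul_assoc, show k + (i + j) = i + k + j by ring]

theorem IsTransform.denom_mul {h : Points K p n R} {χ ψ : Multiplicative (semigroup p n) →* R}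
    (H : h.IsTransform χ ψ) (g : Points K p n R) :
    (g * h).denom χ = g.denom ψ * h.denom χ := H.numer_mul g le_rfl

theorem IsTransform.mul {g h : Points K p n R} {χ ψ ω : Multiplicative (semigroup p n) →* R}
    (H : h.IsTransform χ ψ) (H' : g.IsTransform ψ ω) : (g * h).IsTransform χ ω where
  isUnit := by rw [H.denom_mul]; exact H'.isUnit.mul H.isUnit
  top := by rw [H.denom_mul, ← mul_assoc, H'.top, H.top]
  gap j hj := by rw [H.denom_mul, ← mul_assoc, H'.gap j hj, H.numer_mul g hj]

/-- Justifies the definition of `numer`: where `T = t` is invertible, it is `(gx) ^ p ^ j T ^ p ^ n`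
at `x = t⁻¹`, by `act_pow`. -/
theorem numer_powChar (g : Points K p n R) (t : Rˣ) {j : ℕ} (hj : j ≤ n) :
    g.numer (powChar p n (t : R)) j = g.act ↑t⁻¹ ^ p ^ j * (t : R) ^ p ^ n := by
  rw [numer, act_pow _ _ hj, add_mul, Finset.sum_mul]
  congr 1
  refine Finset.sum_congr rfl fun i hi => ?_
  rw [Finset.mem_range] at hi
  rw [mul_assoc, powChar_ofAdd]
  congr 1
  change (t : R) ^ (p ^ n - p ^ (i + j)) = _
  rw [← Units.val_pow_eq_pow_val, ← Units.val_pow_eq_pow_val, ← Units.val_pow_eq_pow_val,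
    ← Units.val_mul, Units.val_inj, inv_pow, eq_inv_mul_iff_mul_eq, ← pow_add,
    Nat.add_sub_cancel' (Nat.pow_le_pow_right (Fact.out : p.Prime).pos (by omega))]

theorem denom_powChar (g : Points K p n R) (t : Rˣ) :
    g.denom (powChar p n (t : R)) = g.act ↑t⁻¹ ^ p ^ n * (t : R) ^ p ^ n :=
  numer_powChar g t le_rfl

/-- At such a character the denominator is a positive power of `gx` times a unit. So if the
transform is defined there, `gx` again lies in the overlap of the charts. -/
theorem isUnit_act_of_isUnit_denom {g : Points K p n R} {t : Rˣ}
    (h : IsUnit (g.denom (powChar p n (t : R)))) : IsUnit (g.act ↑t⁻¹) := by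
  rw [denom_powChar] at h
  exact (isUnit_pow_iff (p_pow_ne_zero p n)).1 (isUnit_of_mul_isUnit_left h)

/-- Compatibility of the two chartwise actions on the overlap of the charts. -/
theorem isTransform_powChar {g : Points K p n R} {t s : Rˣ} (hs : g.act ↑t⁻¹ = ↑s⁻¹) :
    g.IsTransform (powChar p n (t : R)) (powChar p n (s : R)) where
  isUnit := by
    rw [denom_powChar, hs]
    exact (s⁻¹ ^ p ^ n * t ^ p ^ n).isUnit
  top := by
    rw [denom_powChar, hs]
    change (s : R) ^ p ^ n * _ = (t : R) ^ p ^ n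
    rw [← mul_assoc, ← mul_pow, Units.mul_inv, one_pow, one_mul]
  gap j hj := by
    rw [denom_powChar, numer_powChar _ _ hj, hs, ← mul_assoc]
    congr 1
    change (s : R) ^ (p ^ n - p ^ j) * _ = _
    have hle : p ^ j ≤ p ^ n := Nat.pow_le_pow_right (Fact.out : p.Prime).pos hj
    rw [← Units.val_pow_eq_pow_val, ← Units.val_pow_eq_pow_val, ← Units.val_pow_eq_pow_val,
      ← Units.val_mul, Units.val_inj, inv_pow, inv_pow, mul_inv_eq_iff_eq_mul,
      eq_inv_mul_iff_mul_eq, ← pow_add, Nat.add_sub_cancel' hle]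

end Points

/-! ### Existence of transforms, by descent from Laurent polynomials. -/

section Existence

variable (K p n R)

/-- The inclusion of `R[T^Γ]` into the Laurent polynomial ring `R[T, T⁻¹]`. -/
def semigroupToLaurentOver :
    AddMonoidAlgebra R (semigroup p n) →ₐ[K] LaurentPolynomial R :=
  AddMonoidAlgebra.mapDomainAlgHom K R ((Nat.castAddMonoidHom ℤ).comp (semigroup p n).subtype)

theorem semigroupToLaurentOver_injective :
    Function.Injective (semigroupToLaurentOver K p n R) :=
  AddMonoidAlgebra.mapDomain_injective (Nat.cast_injective.comp Subtype.val_injective)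

theorem semigroupToLaurentOver_of :
    (semigroupToLaurentOver K p n R : _ →* LaurentPolynomial R).comp
      (AddMonoidAlgebra.of R (semigroup p n)) = powChar p n (LaurentPolynomial.T 1) := by
  refine MonoidHom.ext fun a => ?_
  refine (AddMonoidAlgebra.mapDomain_single (r := (1 : R))).trans ?_
  change LaurentPolynomial.T _ = LaurentPolynomial.T 1 ^ (a.toAdd : ℕ)
  rw [LaurentPolynomial.T_pow, mul_one]
  rfl

variable {K p n R}

/-- The evaluation `R[T^Γ] → R` at a character. -/
def evalChar (χ : Multiplicative (semigroup p n) →* R) :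
    AddMonoidAlgebra R (semigroup p n) →ₐ[K] R :=
  (AddMonoidAlgebra.lift R R (semigroup p n) χ).restrictScalars K

theorem evalChar_of (χ : Multiplicative (semigroup p n) →* R) :
    (evalChar (K := K) χ : _ →* R).comp (AddMonoidAlgebra.of R (semigroup p n)) = χ := by
  refine MonoidHom.ext fun a => ?_
  exact AddMonoidAlgebra.lift_of _ _

theorem evalChar_of_apply (χ : Multiplicative (semigroup p n) →* R)
    (a : Multiplicative (semigroup p n)) :
    evalChar (K := K) χ (AddMonoidAlgebra.of R (semigroup p n) a) = χ a :=
  DFunLike.congr_fun (evalChar_of (K := K) χ) a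

theorem evalChar_comp_algebraMap (χ : Multiplicative (semigroup p n) →* R) :
    (evalChar (K := K) χ).comp (IsScalarTower.toAlgHom K R _) = AlgHom.id K R := by
  refine AlgHom.ext fun a => ?_
  exact (AddMonoidAlgebra.lift R R (semigroup p n) χ).commutes a

theorem semigroupToLaurentOver_comp_algebraMap :
    (semigroupToLaurentOver K p n R).comp (IsScalarTower.toAlgHom K R _) =
      IsScalarTower.toAlgHom K R (LaurentPolynomial R) := by
  refine AlgHom.ext fun a => ?_
  exact (AddMonoidAlgebra.mapDomainAlgHom R R
    ((Nat.castAddMonoidHom ℤ).comp (semigroup p n).subtype)).commutes a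

theorem Points.map_map {A : Type u} [CommRing A] [Algebra K A] (f : S →ₐ[K] A) (f' : R →ₐ[K] S)
    (g : Points K p n R) : Points.map f (Points.map f' g) = Points.map (f.comp f') g :=
  Points.ext_coord fun v => by simp only [Points.coord_map, AlgHom.comp_apply]

theorem Points.map_id (g : Points K p n R) : Points.map (AlgHom.id K R) g = g :=
  Points.ext_coord fun v => by simp only [Points.coord_map, AlgHom.id_apply]

namespace Points

/-- The transform of `T⁻¹` under a point, in the Laurent polynomial ring. -/
def laurentAct (g : Points K p n R) : LaurentPolynomial R :=
  (Points.map (IsScalarTower.toAlgHom K R _) g).act (LaurentPolynomial.T (-1))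

/-- The numerator of the transform of `T ^ (p ^ n - p ^ j)` in `R[T^Γ]`. -/
def genNumer (g : Points K p n R) (j : ℕ) : AddMonoidAlgebra R (semigroup p n) :=
  (Points.map (IsScalarTower.toAlgHom K R _) g).numer (AddMonoidAlgebra.of R (semigroup p n)) j

/-- `numer_powChar` applied to the unit `T` of `R[T, T⁻¹]`. -/
theorem semigroupToLaurentOver_genNumer (g : Points K p n R) {j : ℕ} (hj : j ≤ n) :
    semigroupToLaurentOver K p n R (g.genNumer j) =
      g.laurentAct ^ p ^ j * LaurentPolynomial.T 1 ^ p ^ n := by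
  let t : (LaurentPolynomial R)ˣ := ⟨LaurentPolynomial.T 1, LaurentPolynomial.T (-1),
    by rw [← LaurentPolynomial.T_add]; simp, by rw [← LaurentPolynomial.T_add]; simp⟩
  rw [genNumer, ← numer_map, map_map, semigroupToLaurentOver_of,
    semigroupToLaurentOver_comp_algebraMap]
  exact numer_powChar _ t hj

/-- Every character is a specialization of the tautological one, so identities proved in `R[T^Γ]`
hold at all characters, including those that vanish at `T ^ p ^ n`. -/
theorem evalChar_genNumer (g : Points K p n R) (χ : Multiplicative (semigroup p n) →* R) (j : ℕ) :
    evalChar (K := K) χ (g.genNumer j) = g.numer χ j := by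
  rw [genNumer, ← numer_map, map_map, evalChar_of, evalChar_comp_algebraMap, map_id]

/-- The element `b` of `R[T^Γ]` becomes the transform of `T ^ γ` after division by the `N`-th
power of the denominator. -/
def IsLift (g : Points K p n R) (γ : semigroup p n) (N : ℕ)
    (b : AddMonoidAlgebra R (semigroup p n)) : Prop :=
  -- The denominator maps to `(gx) ^ p ^ n T ^ p ^ n`, so `b / D ^ N` is formally `(gx) ^ (m - N p ^
  -- n) = (gx) ^ (-γ)`. The exponent `m` clears the denominator because `gx` need not be invertible.
  ∃ m, (γ : ℕ) + m = N * p ^ n ∧ semigroupToLaurentOver K p n R b =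
    g.laurentAct ^ m * (LaurentPolynomial.T 1 ^ p ^ n) ^ N

theorem IsLift.add {g : Points K p n R} {γ γ' : semigroup p n} {N N' : ℕ}
    {b b' : AddMonoidAlgebra R (semigroup p n)} (h : g.IsLift γ N b) (h' : g.IsLift γ' N' b') :
    g.IsLift (γ + γ') (N + N') (b * b') := by
  obtain ⟨m, hm, hb⟩ := h
  obtain ⟨m', hm', hb'⟩ := h'
  refine ⟨m + m', ?_, ?_⟩
  · rw [AddSubmonoid.coe_add, add_mul, ← hm, ← hm']
    ring
  · rw [map_mul, hb, hb']
    ring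

theorem isLift_zero (g : Points K p n R) : g.IsLift 0 0 1 := ⟨0, by simp, by simp⟩

theorem isLift_top (g : Points K p n R) :
    g.IsLift (topGen p n) 1 (AddMonoidAlgebra.of R (semigroup p n) (.ofAdd (topGen p n))) := by
  refine ⟨0, by simp [topGen], ?_⟩
  rw [pow_zero, one_mul, pow_one]
  exact DFunLike.congr_fun (semigroupToLaurentOver_of K p n R) (.ofAdd (topGen p n))

theorem isLift_gap (g : Points K p n R) {j : ℕ} (hj : j ≤ n) :
    g.IsLift (gapGen p n j) 1 (g.genNumer j) := by
  refine ⟨p ^ j, ?_, ?_⟩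
  · rw [one_mul]
    exact Nat.sub_add_cancel (Nat.pow_le_pow_right (Fact.out : p.Prime).pos hj)
  · rw [semigroupToLaurentOver_genNumer g hj, pow_one]

theorem exists_isLift (g : Points K p n R) (γ : semigroup p n) : ∃ N b, g.IsLift γ N b :=
  semigroup_induction (motive := fun γ => ∃ N b, g.IsLift γ N b) ⟨_, _, g.isLift_top⟩
    (fun _ hj => ⟨_, _, g.isLift_gap hj.le⟩) ⟨_, _, g.isLift_zero⟩
    (fun _ _ ⟨_, _, h⟩ ⟨_, _, h'⟩ => ⟨_, _, h.add h'⟩) γ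

/-- Two lifts define the same fraction. In `R[T, T⁻¹]` both sides are the same monomial in `gx` and
`T ^ p ^ n`, and `R[T^Γ]` embeds there. -/
theorem IsLift.mul_eq_mul {g : Points K p n R} {γ : semigroup p n} {N N' : ℕ}
    {b b' : AddMonoidAlgebra R (semigroup p n)} (h : g.IsLift γ N b) (h' : g.IsLift γ N' b') :
    b * g.genNumer n ^ N' = b' * g.genNumer n ^ N := by
  obtain ⟨m, hm, hb⟩ := h
  obtain ⟨m', hm', hb'⟩ := h'
  apply semigroupToLaurentOver_injective K p n R
  rw [map_mul, map_mul, map_pow, map_pow, hb, hb', semigroupToLaurentOver_genNumer g le_rfl]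
  have e : m + N' * p ^ n = m' + N * p ^ n := by omega
  have h : ∀ m N N', g.laurentAct ^ m * (LaurentPolynomial.T 1 ^ p ^ n) ^ N *
      (g.laurentAct ^ p ^ n * LaurentPolynomial.T 1 ^ p ^ n) ^ N' =
      g.laurentAct ^ (m + N' * p ^ n) * (LaurentPolynomial.T 1 ^ p ^ n) ^ (N + N') :=
    fun m N N' => by
      rw [mul_pow, mul_mul_mul_comm, ← pow_mul, mul_comm (p ^ n) N', ← pow_add, ← pow_add]
  rw [h, h, e, add_comm N]

theorem IsLift.evalChar_mul {g : Points K p n R} {γ : semigroup p n} {N N' : ℕ}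
    {b b' : AddMonoidAlgebra R (semigroup p n)} (h : g.IsLift γ N b) (h' : g.IsLift γ N' b')
    (χ : Multiplicative (semigroup p n) →* R) :
    evalChar (K := K) χ b * g.denom χ ^ N' = evalChar (K := K) χ b' * g.denom χ ^ N := by
  have := congrArg (evalChar (K := K) χ) (h.mul_eq_mul h')
  rwa [map_mul, map_mul, map_pow, map_pow, evalChar_genNumer] at this

/-- A character whose denominator is invertible has a transform. -/
theorem exists_isTransform {g : Points K p n R} {χ : Multiplicative (semigroup p n) →* R}
    (h : IsUnit (g.denom χ)) : ∃ ψ, g.IsTransform χ ψ := by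
  choose N b hb using g.exists_isLift
  obtain ⟨d, hd⟩ := h
  -- The fraction built from the chosen lift `b γ` can be computed with any other lift `c`. This
  -- gives multiplicativity, via products of lifts, and the values on generators.
  have key : ∀ {γ M c}, g.IsLift γ M c →
      evalChar (K := K) χ (b γ) * (↑d⁻¹ : R) ^ N γ * g.denom χ ^ M = evalChar (K := K) χ c := by
    intro γ M c hc
    have := (hb γ).evalChar_mul hc χ
    rw [mul_right_comm, this, mul_assoc, ← hd, ← mul_pow, Units.mul_inv, one_pow, mul_one]
  have cancel : ∀ {M : ℕ} {x y : R}, x * g.denom χ ^ M = y * g.denom χ ^ M → x = y := by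
    intro M x y hxy
    rw [← hd] at hxy
    exact ((d.isUnit).pow M).mul_right_cancel hxy
  let f : semigroup p n → R := fun γ => evalChar (K := K) χ (b γ) * (↑d⁻¹ : R) ^ N γ
  have hzero : f 0 = 1 := by
    have := key g.isLift_zero
    rwa [pow_zero, mul_one, map_one] at this
  have hadd : ∀ γ γ', f (γ + γ') = f γ * f γ' := by
    intro γ γ'
    refine cancel (M := N γ + N γ') ?_
    refine (key ((hb γ).add (hb γ'))).trans ?_
    rw [pow_add, mul_mul_mul_comm, key (hb γ), key (hb γ'), map_mul]
  refine ⟨⟨⟨fun γ => f γ.toAdd, hzero⟩, fun γ γ' => hadd γ.toAdd γ'.toAdd⟩,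
    ⟨d, hd⟩, ?_, fun j hj => ?_⟩
  · have := key g.isLift_top
    rw [pow_one, evalChar_of_apply] at this
    exact this
  · have := key (g.isLift_gap hj)
    rw [pow_one, evalChar_genNumer] at this
    exact this

end Points

end Existence

end Transform

/-! ### Morphisms of `K`-schemes via points in `K`-algebras, and gluing. -/

section AffinePoints

variable {K : Type u} [Field K]

/-- The affine `K`-scheme attached to a `K`-algebra. -/
abbrev aff (R : CommAlgCat.{u} K) : Over (Spec (.of K)) := (toScheme K).obj (op R)

/-- The morphism of affine `K`-schemes attached to a homomorphism of `K`-algebras. -/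
abbrev affMap {R A : CommAlgCat.{u} K} (f : A ⟶ R) : aff R ⟶ aff A := (toScheme K).map f.op

theorem affMap_surjective {R A : CommAlgCat.{u} K} (f : aff R ⟶ aff A) :
    ∃ f' : A ⟶ R, affMap f' = f := by
  have : (toScheme K).Full := algSpec.instFull
  obtain ⟨g, hg⟩ := (toScheme K).map_surjective f
  exact ⟨g.unop, hg⟩

theorem affMap_injective {R A : CommAlgCat.{u} K} {f f' : A ⟶ R} (h : affMap f = affMap f') :
    f = f' := by
  have : (toScheme K).Faithful := algSpec.instFaithful
  exact Quiver.Hom.op_inj ((toScheme K).map_injective h)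

theorem affMap_comp {R A B : CommAlgCat.{u} K} (f : A ⟶ R) (g : B ⟶ A) :
    affMap f ≫ affMap g = affMap (g ≫ f) := ((toScheme K).map_comp _ _).symm

/-- Every point of a `K`-scheme has arbitrarily small affine open neighbourhoods. -/
theorem exists_aff_nhds (W : Over (Spec (.of K))) (x : W.left) (U : W.left.Opens) (hx : x ∈ U) :
    ∃ (R : CommAlgCat.{u} K) (j : aff R ⟶ W) (z : (aff R).left), IsOpenImmersion j.left ∧
      j.left z = x ∧ Set.range j.left ⊆ U := by
  obtain ⟨R, f, hf, ⟨z, hz⟩, hU⟩ := Scheme.exists_affine_mem_range_and_range_subset hx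
  let := (Spec.preimage (f ≫ W.hom)).hom.toAlgebra
  refine ⟨CommAlgCat.of K R, Over.homMk f ?_, z, hf, hz, hU⟩
  exact (Spec.map_preimage (f ≫ W.hom)).symm

/-- Morphisms of `K`-schemes can be compared locally on the source. -/
theorem over_hom_ext_local {W Y : Over (Spec (.of K))} {f g : W ⟶ Y}
    (h : ∀ x : W.left, ∃ (Z : Over (Spec (.of K))) (j : Z ⟶ W), IsOpenImmersion j.left ∧
      x ∈ Set.range j.left ∧ j ≫ f = j ≫ g) : f = g := by
  refine Over.OverMorphism.ext ?_
  choose Z j hj hx hfg using h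
  let 𝒰 : W.left.OpenCover := {
    I₀ := W.left, X i := (Z i).left, f i := (j i).left,
    mem₀ := by
      rw [Scheme.presieve₀_mem_precoverage_iff]
      exact ⟨fun x => ⟨x, hx x⟩, hj⟩ }
  exact 𝒰.hom_ext _ _ fun x => congrArg (fun k : Z x ⟶ Y => k.left) (hfg x)

/-- Morphisms of `K`-schemes can be compared on points with values in `K`-algebras. -/
theorem over_hom_ext_points {W Y : Over (Spec (.of K))} {f g : W ⟶ Y}
    (h : ∀ (R : CommAlgCat.{u} K) (j : aff R ⟶ W), j ≫ f = j ≫ g) : f = g :=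
  over_hom_ext_local fun x => by
    obtain ⟨R, j, z, hj, hz, _⟩ := exists_aff_nhds W x ⊤ trivial
    exact ⟨aff R, j, hj, ⟨z, hz⟩, h R j⟩

/-- The fibre product of two `K`-schemes over a third one. -/
def overPullback {A B W : Over (Spec (.of K))} (i : A ⟶ W) (j : B ⟶ W) : Over (Spec (.of K)) :=
  Over.mk (pullback.fst i.left j.left ≫ A.hom)

/-- The first projection of the fibre product. -/
def overPullbackFst {A B W : Over (Spec (.of K))} (i : A ⟶ W) (j : B ⟶ W) :
    overPullback i j ⟶ A := Over.homMk (pullback.fst i.left j.left) rfl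

/-- The second projection of the fibre product. -/
def overPullbackSnd {A B W : Over (Spec (.of K))} (i : A ⟶ W) (j : B ⟶ W) :
    overPullback i j ⟶ B := Over.homMk (pullback.snd i.left j.left) (by
  have h : pullback.snd i.left j.left ≫ B.hom = pullback.fst i.left j.left ≫ A.hom := by
    rw [← Over.w i, ← Over.w j, ← Category.assoc, ← Category.assoc, pullback.condition]
  exact h)

theorem overPullback_condition {A B W : Over (Spec (.of K))} (i : A ⟶ W) (j : B ⟶ W) :
    overPullbackFst i j ≫ i = overPullbackSnd i j ≫ j :=
  Over.OverMorphism.ext pullback.condition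

/-- A functional relation between the points of two `K`-schemes which is defined locally on the
source comes from a morphism. -/
theorem exists_hom_of_rel {W Y : Over (Spec (.of K))}
    (rel : ∀ {R : CommAlgCat.{u} K}, (aff R ⟶ W) → (aff R ⟶ Y) → Prop)
    (nat : ∀ {R R' : CommAlgCat.{u} K} (f : aff R' ⟶ aff R) (j : aff R ⟶ W) (m : aff R ⟶ Y),
      rel j m → rel (f ≫ j) (f ≫ m))
    (func : ∀ {R : CommAlgCat.{u} K} (j : aff R ⟶ W) (m m' : aff R ⟶ Y),
      rel j m → rel j m' → m = m')
    (loc : ∀ x : W.left, ∃ (R : CommAlgCat.{u} K) (j : aff R ⟶ W) (m : aff R ⟶ Y),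
      IsOpenImmersion j.left ∧ x ∈ Set.range j.left ∧ rel j m) :
    ∃ f : W ⟶ Y, ∀ (R : CommAlgCat.{u} K) (j : aff R ⟶ W) (m : aff R ⟶ Y),
      rel j m → j ≫ f = m := by
  -- Agreement on the fibre product is tested on affine points, where both composites are related to
  -- one and the same point of `W`; `func` then identifies them.
  have compat : ∀ {R R' : CommAlgCat.{u} K} {i : aff R ⟶ W} {i' : aff R' ⟶ W}
      {m : aff R ⟶ Y} {m' : aff R' ⟶ Y}, rel i m → rel i' m' →
      overPullbackFst i i' ≫ m = overPullbackSnd i i' ≫ m' := by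
    intro R R' i i' m m' h h'
    refine over_hom_ext_points fun A k => func (k ≫ overPullbackFst i i' ≫ i) _ _ ?_ ?_
    · have := nat (k ≫ overPullbackFst i i') _ _ h
      rwa [Category.assoc, Category.assoc] at this
    · have := nat (k ≫ overPullbackSnd i i') _ _ h'
      rwa [Category.assoc, Category.assoc, ← overPullback_condition] at this
  choose R j m hj hx hrel using loc
  let 𝒰 : W.left.OpenCover := {
    I₀ := W.left, X i := (aff (R i)).left, f i := (j i).left,
    mem₀ := by
      rw [Scheme.presieve₀_mem_precoverage_iff]
      exact ⟨fun x => ⟨x, hx x⟩, hj⟩ }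
  let f₀ : W.left ⟶ Y.left := 𝒰.glueMorphisms (fun x => (m x).left) fun x y =>
    congrArg (fun k : overPullback (j x) (j y) ⟶ Y => k.left) (compat (hrel x) (hrel y))
  have hf₀ : ∀ x, (j x).left ≫ f₀ = (m x).left := fun x => 𝒰.ι_glueMorphisms _ _ x
  let f : W ⟶ Y := Over.homMk f₀ (𝒰.hom_ext _ _ fun x => by
    change (j x).left ≫ f₀ ≫ Y.hom = (j x).left ≫ W.hom
    rw [← Category.assoc, hf₀, Over.w, Over.w])
  have hf : ∀ x, j x ≫ f = m x := fun x => Over.OverMorphism.ext (hf₀ x)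
  refine ⟨f, fun R' i m' h => over_hom_ext_local fun z => ?_⟩
  have := hj (i.left z)
  -- The point `i` need not belong to the chosen cover. Pulling the cover back along `i` reduces the
  -- claim to `compat`.
  refine ⟨overPullback i (j (i.left z)), overPullbackFst _ _, ?_, ?_, ?_⟩
  · exact inferInstanceAs (IsOpenImmersion (pullback.fst i.left (j (i.left z)).left))
  · change z ∈ Set.range (pullback.fst i.left (j (i.left z)).left)
    rw [IsOpenImmersion.range_pullbackFst]
    exact hx (i.left z)
  · rw [compat h (hrel (i.left z)), ← Category.assoc, overPullback_condition, Category.assoc, hf]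

/-- The prime ideal of a `K`-algebra corresponding to a point of its spectrum. -/
def ptIdeal {R : CommAlgCat.{u} K} (z : (aff R).left) : Ideal R := PrimeSpectrum.asIdeal z

instance {R : CommAlgCat.{u} K} (z : (aff R).left) : (ptIdeal z).IsPrime := PrimeSpectrum.isPrime z

theorem mem_ptIdeal_affMap {R A : CommAlgCat.{u} K} (f : A ⟶ R) (z : (aff R).left) (a : A) :
    a ∈ ptIdeal ((affMap f).left z) ↔ f.hom a ∈ ptIdeal z := Iff.rfl

/-- The inclusion of the locus where an element of a `K`-algebra is invertible. -/
theorem exists_localization (R : CommAlgCat.{u} K) (z : (aff R).left) (s : R)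
    (hs : s ∉ ptIdeal z) :
    ∃ (R' : CommAlgCat.{u} K) (f : R ⟶ R') (z' : (aff R').left),
      IsOpenImmersion (affMap f).left ∧ (affMap f).left z' = z ∧ IsUnit (f.hom s) := by
  let f : R →ₐ[K] Localization.Away s := IsScalarTower.toAlgHom K R (Localization.Away s)
  have hf : IsOpenImmersion (affMap (CommAlgCat.ofHom f)).left :=
    IsOpenImmersion.of_isLocalization (S := Localization.Away s) s
  have hz : z ∈ Set.range (affMap (CommAlgCat.ofHom f)).left := by
    change z ∈ Set.range (PrimeSpectrum.comap (algebraMap R (Localization.Away s)))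
    rw [PrimeSpectrum.localization_away_comap_range (Localization.Away s) s]
    exact hs
  obtain ⟨z', hz'⟩ := hz
  exact ⟨CommAlgCat.of K (Localization.Away s), CommAlgCat.ofHom f, z', hf, hz',
    IsLocalization.Away.algebraMap_isUnit s⟩

end AffinePoints

/-! ### Points of the two charts of `X_{p,n}` and of their overlap. -/

section Charts

set_option linter.unusedSectionVars false

variable {K : Type u} [Field K] {p : ℕ} [Fact p.Prime] [CharP K p] {n : ℕ}
variable {R R' : CommAlgCat.{u} K}

theorem semigroupChart_structure : semigroupChart K p n ≫ compactificationStructure K p n =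
    Spec.map (CommRingCat.ofHom (algebraMap K (SemigroupRing K p n))) :=
  pushout.inl_desc _ _ _

variable (K p n) in
/-- The open immersion `Spec K[T^Γ] ⊆ X_{p,n}` over `K`. -/
def semiIncl : aff (CommAlgCat.of K (SemigroupRing K p n)) ⟶ X K p n :=
  Over.homMk (semigroupChart K p n) semigroupChart_structure

instance : IsOpenImmersion (semiIncl K p n).left :=
  inferInstanceAs (IsOpenImmersion (semigroupChart K p n))

instance mono_semiIncl : Mono (semiIncl K p n) := Over.mono_of_mono_left _

instance mono_ι : Mono (ι K p n) := Over.mono_of_mono_left _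

theorem mem_range_chart (x : (X K p n).left) :
    x ∈ (ι K p n).left.opensRange ∨ x ∈ (semiIncl K p n).left.opensRange := by
  obtain ⟨i, y, hy⟩ := Scheme.IsLocallyDirected.ι_jointly_surjective
    (span (overlapToSemigroup K p n) (overlapToLine K)) x
  rcases i with _ | _ | _
  · refine Or.inl ⟨overlapToLine K y, ?_⟩
    rw [← hy, ← colimit.w (span (overlapToSemigroup K p n) (overlapToLine K))
      WalkingSpan.Hom.snd, Scheme.Hom.comp_apply]
    rfl
  · exact Or.inr ⟨y, hy⟩
  · exact Or.inl ⟨y, hy⟩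

/-- The point of the group scheme attached to an element of `𝔾_a(R) ⋊ U_n(R) ⋊ 𝔾_m(R)`. -/
def grpPt (g : Points K p n R) : aff R ⟶ G K p n :=
  affMap (CommAlgCat.ofHom ((algHomEquiv K p n R).symm g))

/-- The point of the affine line attached to an element of a `K`-algebra. -/
def linePt (a : R) : aff R ⟶ A1 K :=
  affMap (CommAlgCat.ofHom (Polynomial.aeval a))

/-- The point of `Spec K[T^Γ]` attached to a character of `Γ`. -/
def semiPt (χ : Multiplicative (semigroup p n) →* R) :
    aff R ⟶ aff (CommAlgCat.of K (SemigroupRing K p n)) :=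
  affMap (CommAlgCat.ofHom (AddMonoidAlgebra.lift K R (semigroup p n) χ))

theorem grpPt_surjective (x : aff R ⟶ G K p n) : ∃ g, grpPt g = x := by
  obtain ⟨f, rfl⟩ := affMap_surjective (A := CommAlgCat.of K (CoordRing K p n)) x
  exact ⟨algHomEquiv K p n R f.hom, by rw [grpPt, Equiv.symm_apply_apply]; rfl⟩

theorem grpPt_injective {g h : Points K p n R} (e : grpPt g = grpPt h) : g = h :=
  (algHomEquiv K p n R).symm.injective
    (congrArg CommAlgCat.Hom.hom (affMap_injective (A := CommAlgCat.of K (CoordRing K p n)) e))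

theorem linePt_surjective (x : aff R ⟶ A1 K) : ∃ a, linePt a = x := by
  obtain ⟨f, rfl⟩ := affMap_surjective (A := CommAlgCat.of K (Polynomial K)) x
  refine ⟨f.hom Polynomial.X, congrArg affMap (CommAlgCat.hom_ext (Polynomial.algHom_ext ?_))⟩
  exact Polynomial.aeval_X _

theorem linePt_injective {a b : R} (e : linePt (K := K) a = linePt b) : a = b := by
  have h := DFunLike.congr_fun (congrArg CommAlgCat.Hom.hom
    (affMap_injective (A := CommAlgCat.of K (Polynomial K)) e)) Polynomial.X
  exact (Polynomial.aeval_X a).symm.trans (h.trans (Polynomial.aeval_X b))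

theorem semiPt_surjective (x : aff R ⟶ aff (CommAlgCat.of K (SemigroupRing K p n))) :
    ∃ χ, semiPt χ = x := by
  obtain ⟨f, rfl⟩ := affMap_surjective x
  exact ⟨(AddMonoidAlgebra.lift K R (semigroup p n)).symm f.hom, by
    rw [semiPt, Equiv.apply_symm_apply]; rfl⟩

theorem semiPt_injective {χ ψ : Multiplicative (semigroup p n) →* R} (e : semiPt χ = semiPt ψ) :
    χ = ψ :=
  (AddMonoidAlgebra.lift K R (semigroup p n)).injective
    (congrArg CommAlgCat.Hom.hom (affMap_injective e))

theorem affMap_grpPt (f : R ⟶ R') (g : Points K p n R) :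
    affMap f ≫ grpPt g = grpPt (Points.map f.hom g) := by
  rw [grpPt, grpPt]
  refine (affMap_comp f _).trans (congrArg affMap (CommAlgCat.hom_ext ?_))
  apply (algHomEquiv K p n R').injective
  refine (algHomEquiv_comp f.hom _).trans ?_
  exact (congrArg _ ((algHomEquiv K p n R).apply_symm_apply g)).trans
    ((algHomEquiv K p n R').apply_symm_apply _).symm

theorem affMap_linePt (f : R ⟶ R') (a : R) :
    affMap f ≫ linePt a = linePt (f.hom a) := by
  refine (affMap_comp f _).trans (congrArg affMap (CommAlgCat.hom_ext (Polynomial.algHom_ext ?_)))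
  exact (congrArg f.hom (Polynomial.aeval_X a)).trans (Polynomial.aeval_X _).symm

theorem affMap_semiPt (f : R ⟶ R') (χ : Multiplicative (semigroup p n) →* R) :
    affMap f ≫ semiPt χ = semiPt ((f.hom : R →* R').comp χ) := by
  refine (affMap_comp f _).trans (congrArg affMap (CommAlgCat.hom_ext
    (AddMonoidAlgebra.algHom_ext' (MonoidHom.ext fun a => ?_) (Subsingleton.elim _ _))))
  exact (congrArg f.hom (AddMonoidAlgebra.lift_of χ a)).trans
    (AddMonoidAlgebra.lift_of ((f.hom : R →* R').comp χ) a).symm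

/-- The points of `X_{p,n}` lying on both charts are the powers of a unit. -/
theorem semiPt_powChar (t : Rˣ) : semiPt (powChar p n (t : R)) ≫ semiIncl K p n =
    linePt (↑t⁻¹ : R) ≫ ι K p n := by
  let c : LaurentPolynomial K →ₐ[K] R := AddMonoidAlgebra.lift K R ℤ
    ((Units.coeHom R).comp (zpowersHom Rˣ t))
  have hc : ∀ m : ℤ, c (LaurentPolynomial.T m) = ((t ^ m : Rˣ) : R) := fun m =>
    (AddMonoidAlgebra.lift_single _ _ _).trans (one_smul _ _)
  have h₁ : affMap (CommAlgCat.ofHom c) ≫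
      affMap (CommAlgCat.ofHom (semigroupToLaurent K p n)) = semiPt (powChar p n (t : R)) := by
    refine (affMap_comp _ _).trans (congrArg affMap (CommAlgCat.hom_ext
      (AddMonoidAlgebra.algHom_ext' (MonoidHom.ext fun a => ?_) (Subsingleton.elim _ _))))
    refine (congrArg c (semigroupToLaurent_single K p n a.toAdd 1)).trans ?_
    rw [map_one, one_mul, hc, zpow_natCast, Units.val_pow_eq_pow_val]
    exact (AddMonoidAlgebra.lift_of (powChar p n (t : R)) a).symm
  have h₂ : affMap (CommAlgCat.ofHom c) ≫
      affMap (CommAlgCat.ofHom (lineToLaurent K)) = linePt (↑t⁻¹ : R) := by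
    refine (affMap_comp _ _).trans (congrArg affMap (CommAlgCat.hom_ext
      (Polynomial.algHom_ext ?_)))
    refine (congrArg c (Polynomial.aeval_X _)).trans ?_
    rw [hc, zpow_neg_one]
    exact (Polynomial.aeval_X _).symm
  have h₃ : affMap (CommAlgCat.ofHom (semigroupToLaurent K p n)) ≫ semiIncl K p n =
      affMap (CommAlgCat.ofHom (lineToLaurent K)) ≫ ι K p n :=
    Over.OverMorphism.ext
      (pushout.condition (f := overlapToSemigroup K p n) (g := overlapToLine K))
  rw [← h₁, ← h₂, Category.assoc, h₃]
  exact (Category.assoc _ _ _).symm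

/-- Converse of `semiPt_powChar`: a point lying on both charts factors through `Spec K[T, T⁻¹]`, and
the unit is the image of `T`. -/
theorem exists_unit_of_linePt_eq {a : R} {χ : Multiplicative (semigroup p n) →* R}
    (h : linePt a ≫ ι K p n = semiPt χ ≫ semiIncl K p n) :
    ∃ t : Rˣ, a = ↑t⁻¹ ∧ χ = powChar p n (t : R) := by
  have hrange : Set.range (linePt (K := K) a).left ⊆ Set.range (overlapToLine K) := by
    rintro _ ⟨z, rfl⟩
    have hz : colimit.ι (span (overlapToSemigroup K p n) (overlapToLine K)) WalkingSpan.right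
        ((linePt (K := K) a).left z) =
        colimit.ι (span (overlapToSemigroup K p n) (overlapToLine K)) WalkingSpan.left
        ((semiPt χ).left z) :=
      congrArg (fun f : aff R ⟶ X K p n => f.left z) h
    -- Two points of the charts are identified only through an object of the span mapping to both.
    -- There is no arrow between the two charts, so this object is the overlap.
    obtain ⟨k, f₁, f₂, y, h₁, -⟩ := (Scheme.IsLocallyDirected.ι_eq_ι_iff _).1 hz
    rcases k with _ | _ | _
    · obtain rfl : f₁ = WalkingSpan.Hom.snd := Subsingleton.elim _ _
      exact ⟨y, h₁⟩
    · change WidePushoutShape.Hom _ _ at f₁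
      cases f₁
    · change WidePushoutShape.Hom _ _ at f₂
      cases f₂
  let c₀ : Spec (.of R) ⟶ Spec (.of (LaurentPolynomial K)) :=
    IsOpenImmersion.lift (overlapToLine K) (linePt (K := K) a).left hrange
  have hc₀ : c₀ ≫ overlapToLine K = (linePt (K := K) a).left := IsOpenImmersion.lift_fac _ _ _
  let c₁ : aff R ⟶ aff (CommAlgCat.of K (LaurentPolynomial K)) := Over.homMk c₀ (by
    refine Eq.trans ?_ (Over.w (linePt a))
    rw [← hc₀]
    refine Eq.trans ?_ (Category.assoc c₀ (overlapToLine K) (A1 K).hom).symm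
    exact congrArg (c₀ ≫ ·) (Over.w (affMap (CommAlgCat.ofHom (lineToLaurent K)))).symm)
  obtain ⟨c, hc⟩ := affMap_surjective c₁
  have hline : affMap (CommAlgCat.ofHom (lineToLaurent K) ≫ c) = linePt a := by
    rw [← affMap_comp, hc]
    exact Over.OverMorphism.ext hc₀
  let t : Rˣ := Units.map (c.hom : LaurentPolynomial K →* R)
    ⟨LaurentPolynomial.T 1, LaurentPolynomial.T (-1),
      by rw [← LaurentPolynomial.T_add]; simp, by rw [← LaurentPolynomial.T_add]; simp⟩
  have ha : a = ↑t⁻¹ := by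
    have := DFunLike.congr_fun (congrArg CommAlgCat.Hom.hom
      (affMap_injective (A := CommAlgCat.of K (Polynomial K)) hline)) Polynomial.X
    refine ((Polynomial.aeval_X a).symm.trans this.symm).trans ?_
    exact congrArg c.hom (Polynomial.aeval_X _)
  refine ⟨t, ha, ?_⟩
  -- Once `a` is known, `χ` follows because the chart `Spec K[T^Γ]` is a monomorphism.
  rw [ha, ← semiPt_powChar t, cancel_mono] at h
  exact (semiPt_injective h).symm

end Charts

/-! ### Gluing the chartwise actions. -/

section Action

set_option linter.unusedSectionVars false

variable {K : Type u} [Field K] {p : ℕ} [Fact p.Prime] [CharP K p] {n : ℕ}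
variable {R R' : CommAlgCat.{u} K}

/-- A character which is invertible at `p ^ n` consists of the powers of a unit. -/
theorem exists_eq_powChar {A : Type u} [CommRing A] {χ : Multiplicative (semigroup p n) →* A}
    (h : IsUnit (χ (.ofAdd (topGen p n)))) : ∃ t : Aˣ, χ = powChar p n (t : A) := by
  have hpos : 1 ≤ p ^ n := Nat.one_le_pow _ _ (Fact.out : p.Prime).pos
  have hgap : ((gapGen p n 0 : semigroup p n) : ℕ) = p ^ n - 1 := by
    change p ^ n - p ^ 0 = _
    rw [pow_zero]
  have h₁ : χ (.ofAdd (gapGen p n 0)) ^ p ^ n = χ (.ofAdd (topGen p n)) ^ (p ^ n - 1) := by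
    -- This relation makes `χ` invertible at `p ^ n - 1` as well, so that `t = χ(p ^ n) / χ(p ^ n -
    -- 1)` makes sense.
    have h : p ^ n • gapGen p n 0 = (p ^ n - 1) • topGen p n := Subtype.ext (by
      rw [AddSubmonoidClass.coe_nsmul, AddSubmonoidClass.coe_nsmul, hgap]
      exact mul_comm _ _)
    exact (map_pow χ _ _).symm.trans ((congrArg (fun b => χ (.ofAdd b)) h).trans (map_pow χ _ _))
  obtain ⟨s, hs⟩ : IsUnit (χ (.ofAdd (gapGen p n 0))) :=
    (isUnit_pow_iff (p_pow_ne_zero p n)).1 (h₁ ▸ h.pow _)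
  obtain ⟨S, hS⟩ := h
  refine ⟨S * s⁻¹, MonoidHom.ext fun a => ?_⟩
  have h₂ : χ a * χ (.ofAdd (gapGen p n 0)) ^ (a.toAdd : ℕ) =
      χ (.ofAdd (topGen p n)) ^ (a.toAdd : ℕ) := by
    -- The relation `γ + γ (p ^ n - 1) = γ p ^ n` gives `χ(γ) = t ^ γ`.
    have h : a.toAdd + (a.toAdd : ℕ) • gapGen p n 0 = (a.toAdd : ℕ) • topGen p n :=
      Subtype.ext (by
        rw [AddSubmonoid.coe_add, AddSubmonoidClass.coe_nsmul, AddSubmonoidClass.coe_nsmul, hgap]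
        change (a.toAdd : ℕ) + (a.toAdd : ℕ) * (p ^ n - 1) = (a.toAdd : ℕ) * p ^ n
        rw [Nat.mul_sub, mul_one, Nat.add_sub_cancel' (Nat.le_mul_of_pos_right _ hpos)])
    exact (congrArg (χ a * ·) (map_pow χ _ _).symm).trans ((map_mul χ _ _).symm.trans
      ((congrArg (fun b => χ (.ofAdd b)) h).trans (map_pow χ _ _)))
  change χ a = ((S * s⁻¹ : Aˣ) : A) ^ (a.toAdd : ℕ)
  rw [← hs, ← hS, ← Units.val_pow_eq_pow_val, ← Units.val_pow_eq_pow_val] at h₂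
  rw [← Units.val_pow_eq_pow_val, mul_pow, inv_pow, Units.val_mul, ← h₂, mul_assoc,
    Units.mul_inv, mul_one]

/-- The relation between the points of `X_{p,n}` given by the action of a point of
`𝔾_a ⋊ U_n ⋊ 𝔾_m` on one of the two charts. -/
inductive ActRel (g : Points K p n R) : (aff R ⟶ X K p n) → (aff R ⟶ X K p n) → Prop
  | line (a : R) : ActRel g (linePt a ≫ ι K p n) (linePt (g.act a) ≫ ι K p n)
  | semi {χ ψ : Multiplicative (semigroup p n) →* R} (h : g.IsTransform χ ψ) :
      ActRel g (semiPt χ ≫ semiIncl K p n) (semiPt ψ ≫ semiIncl K p n)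

theorem ActRel.comp {g : Points K p n R} {x y : aff R ⟶ X K p n} (h : ActRel g x y)
    (f : R ⟶ R') : ActRel (Points.map f.hom g) (affMap f ≫ x) (affMap f ≫ y) := by
  cases h with
  | line a =>
    rw [← Category.assoc, ← Category.assoc, affMap_linePt, affMap_linePt, ← Points.act_map]
    exact .line _
  | semi h =>
    rw [← Category.assoc, ← Category.assoc, affMap_semiPt, affMap_semiPt]
    exact .semi (h.map f.hom)

/-- The mixed case of uniqueness. A point on both charts is given by a unit `t`; the invertible
denominator makes `g.act t⁻¹` a unit, so both recipes land in the overlap and agree by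
`isTransform_powChar`. -/
theorem ActRel.eq_of_line {g : Points K p n R} {x y : aff R ⟶ X K p n} (h : ActRel g x y) {a : R}
    (hx : x = linePt a ≫ ι K p n) : y = linePt (g.act a) ≫ ι K p n := by
  cases h with
  | line b =>
    rw [cancel_mono] at hx
    rw [linePt_injective hx]
  | semi h =>
    obtain ⟨t, rfl, rfl⟩ := exists_unit_of_linePt_eq hx.symm
    obtain ⟨s, hs⟩ := Points.isUnit_act_of_isUnit_denom h.isUnit
    rw [h.unique (Points.isTransform_powChar (s := s⁻¹) (by rw [inv_inv, hs])), semiPt_powChar,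
      inv_inv, hs]

theorem ActRel.unique {g : Points K p n R} {x y y' : aff R ⟶ X K p n} (h : ActRel g x y)
    (h' : ActRel g x y') : y = y' := by
  cases h with
  | line a => exact (h'.eq_of_line rfl).symm
  | semi h =>
    -- The source is made a variable, with its equation kept, so that the second relation can be
    -- split into cases.
    generalize hx : semiPt _ ≫ semiIncl K p n = x at h'
    cases h' with
    | line a => exact ActRel.eq_of_line (.semi h) hx
    | semi h' =>
      rw [cancel_mono] at hx
      obtain rfl := semiPt_injective hx
      rw [h.unique h']

/-- Locally, a point of `X_{p,n}` lies in the affine line or near the point at infinity of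
`Spec K[T^Γ]`. -/
theorem exists_local_chart {W : Over (Spec (.of K))} (c : W ⟶ X K p n) (x : W.left) :
    ∃ (R : CommAlgCat.{u} K) (j : aff R ⟶ W) (z : (aff R).left), IsOpenImmersion j.left ∧
      j.left z = x ∧ ((∃ a : R, j ≫ c = linePt a ≫ ι K p n) ∨
        ∃ χ : Multiplicative (semigroup p n) →* R, j ≫ c = semiPt χ ≫ semiIncl K p n ∧
          χ (.ofAdd (topGen p n)) ∈ ptIdeal z) := by
  have lift : ∀ {A : Over (Spec (.of K))} (i : A ⟶ X K p n) [IsOpenImmersion i.left],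
      c.left x ∈ i.left.opensRange → ∃ (R : CommAlgCat.{u} K) (j : aff R ⟶ W)
        (z : (aff R).left) (k : aff R ⟶ A), IsOpenImmersion j.left ∧ j.left z = x ∧
          j ≫ c = k ≫ i := by
    intro A i _ hx
    obtain ⟨R, j, z, hj, hz, hU⟩ := exists_aff_nhds W x (c.left ⁻¹ᵁ i.left.opensRange) hx
    have hr : Set.range (j ≫ c).left ⊆ Set.range i.left := by
      rintro _ ⟨y, rfl⟩
      exact hU ⟨y, rfl⟩
    refine ⟨R, j, z, Over.homMk (IsOpenImmersion.lift i.left (j ≫ c).left hr) ?_, hj, hz, ?_⟩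
    · rw [← Over.w i, ← Category.assoc, IsOpenImmersion.lift_fac, Over.w]
    · exact Over.OverMorphism.ext (IsOpenImmersion.lift_fac i.left (j ≫ c).left hr).symm
  rcases mem_range_chart (c.left x) with hx | hx
  · obtain ⟨R, j, z, k, hj, hz, hk⟩ := lift (ι K p n) hx
    obtain ⟨a, rfl⟩ := linePt_surjective k
    exact ⟨R, j, z, hj, hz, Or.inl ⟨a, hk⟩⟩
  · obtain ⟨R, j, z, k, hj, hz, hk⟩ := lift (semiIncl K p n) hx
    obtain ⟨χ, rfl⟩ := semiPt_surjective k
    by_cases hχ : χ (.ofAdd (topGen p n)) ∈ ptIdeal z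
    · exact ⟨R, j, z, hj, hz, Or.inr ⟨χ, hk, hχ⟩⟩
    -- Where `T ^ p ^ n` is nonzero at the point it becomes a unit after shrinking, and the point
    -- moves to the line chart. Only points at infinity remain in the other case.
    · obtain ⟨R', f, z', hf, hz', hu⟩ := exists_localization R z _ hχ
      obtain ⟨t, ht⟩ := exists_eq_powChar (χ := (f.hom : R →* R').comp χ) hu
      refine ⟨R', affMap f ≫ j, z', ?_, ?_, Or.inl ⟨↑t⁻¹, ?_⟩⟩
      · exact inferInstanceAs (IsOpenImmersion ((affMap f).left ≫ j.left))
      · rw [← hz, ← hz']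
        rfl
      · rw [Category.assoc, hk, ← semiPt_powChar, ← ht, ← affMap_semiPt, Category.assoc]

/-- Near the point at infinity of `Spec K[T^Γ]`, the transform of a character is defined. -/
theorem exists_local_transform (g : Points K p n R) (χ : Multiplicative (semigroup p n) →* R)
    (z : (aff R).left) (hχ : χ (.ofAdd (topGen p n)) ∈ ptIdeal z) :
    ∃ (R' : CommAlgCat.{u} K) (f : R ⟶ R') (z' : (aff R').left)
      (ψ : Multiplicative (semigroup p n) →* R'), IsOpenImmersion (affMap f).left ∧
      (affMap f).left z' = z ∧
      (Points.map f.hom g).IsTransform ((f.hom : R →* R').comp χ) ψ ∧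
      ψ (.ofAdd (topGen p n)) ∈ ptIdeal z' := by
  -- At `z` the denominator reduces to `λ₀ ^ p ^ n`, which is a unit.
  have hd : g.denom χ ∉ ptIdeal z := by
    intro hmem
    rw [Points.denom_eq, Ideal.add_mem_iff_left _ (Ideal.mul_mem_left _ _ hχ)] at hmem
    exact Ideal.IsPrime.ne_top' (Ideal.eq_top_of_isUnit_mem _ hmem (g.lam0.isUnit.pow _))
  obtain ⟨R', f, z', hf, hz', hu⟩ := exists_localization R z _ hd
  have hu' : IsUnit ((Points.map f.hom g).denom ((f.hom : R →* R').comp χ)) := by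
    rw [Points.denom_map]
    exact hu
  obtain ⟨ψ, hψ⟩ := Points.exists_isTransform hu'
  refine ⟨R', f, z', ψ, hf, hz', hψ, ?_⟩
  rw [← hz', mem_ptIdeal_affMap] at hχ
  -- The transform still vanishes at `T ^ p ^ n`: the point at infinity is stable, so further group
  -- elements can be applied near it.
  have hmul : ψ (.ofAdd (topGen p n)) * (Points.map f.hom g).denom ((f.hom : R →* R').comp χ) ∈
      ptIdeal z' := hψ.top ▸ hχ
  exact (Ideal.IsPrime.mem_or_mem inferInstance hmul).resolve_right fun hmem =>
    Ideal.IsPrime.ne_top' (Ideal.eq_top_of_isUnit_mem _ hmem hu')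

variable (K p n) in
/-- The actions on the two charts of `X_{p,n}` glue to a morphism. -/
theorem exists_actMor : ∃ act : G K p n ⊗ X K p n ⟶ X K p n,
    ∀ (R : CommAlgCat.{u} K) (g : Points K p n R) (x y : aff R ⟶ X K p n),
      ActRel g x y → lift (grpPt g) x ≫ act = y := by
  -- The graph of the action. It is only a partial relation on `R`-points, since one point may meet
  -- both charts or have a non-invertible denominator; `exists_hom_of_rel` needs it to be total only
  -- locally.
  let rel : ∀ {R : CommAlgCat.{u} K}, (aff R ⟶ G K p n ⊗ X K p n) → (aff R ⟶ X K p n) → Prop :=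
    fun {R} j m => ∃ g : Points K p n R, grpPt g = j ≫ fst _ _ ∧ ActRel g (j ≫ snd _ _) m
  suffices h : ∃ act : G K p n ⊗ X K p n ⟶ X K p n, ∀ (R : CommAlgCat.{u} K) j m,
      rel (R := R) j m → j ≫ act = m by
    obtain ⟨act, h⟩ := h
    exact ⟨act, fun R g x y hxy => h R _ _ ⟨g, by rw [lift_fst], by rwa [lift_snd]⟩⟩
  refine exists_hom_of_rel rel ?_ ?_ ?_
  · rintro R R' f j m ⟨g, hg, hm⟩
    obtain ⟨f, rfl⟩ := affMap_surjective f
    refine ⟨Points.map f.hom g, ?_, ?_⟩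
    · rw [Category.assoc, ← hg, affMap_grpPt]
    · rw [Category.assoc]
      exact hm.comp f
  · rintro R j m m' ⟨g, hg, hm⟩ ⟨g', hg', hm'⟩
    obtain rfl := grpPt_injective (hg.trans hg'.symm)
    exact hm.unique hm'
  · intro x
    obtain ⟨R, j, z, hj, hz, ⟨a, ha⟩ | ⟨χ, hχ, hmem⟩⟩ := exists_local_chart (snd _ _) x
    · obtain ⟨g, hg⟩ := grpPt_surjective (j ≫ fst _ _)
      refine ⟨R, j, linePt (g.act a) ≫ ι K p n, hj, ⟨z, hz⟩, g, hg, ?_⟩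
      rw [ha]
      exact .line a
    · obtain ⟨g, hg⟩ := grpPt_surjective (j ≫ fst _ _)
      obtain ⟨R', f, z', ψ, hf, hz', hψ, -⟩ := exists_local_transform g χ z hmem
      refine ⟨R', affMap f ≫ j, semiPt ψ ≫ semiIncl K p n, ?_, ⟨z', ?_⟩,
        Points.map f.hom g, ?_, ?_⟩
      · exact inferInstanceAs (IsOpenImmersion ((affMap f).left ≫ j.left))
      · rw [← hz, ← hz']
        rfl
      · rw [Category.assoc, ← hg, affMap_grpPt]
      · rw [Category.assoc, hχ, ← Category.assoc, affMap_semiPt]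
        exact .semi hψ

theorem grpPt_mul (g h : Points K p n R) :
    lift (grpPt g) (grpPt h) ≫ MonObj.mul = grpPt (g * h) := by
  let g' : op R ⟶ affG K p n := (CommAlgCat.ofHom ((algHomEquiv K p n R).symm g)).op
  let h' : op R ⟶ affG K p n := (CommAlgCat.ofHom ((algHomEquiv K p n R).symm h)).op
  have hmul : lift g' h' ≫ MonObj.mul =
      (CommAlgCat.ofHom ((algHomEquiv K p n R).symm (g * h))).op := by
    refine Quiver.Hom.unop_inj (CommAlgCat.hom_ext ((algHomEquiv K p n R).injective ?_))
    refine (algHomEquiv_mul (op R) g' h').trans ?_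
    change algHomEquiv K p n R ((algHomEquiv K p n R).symm g) *
      algHomEquiv K p n R ((algHomEquiv K p n R).symm h) =
      algHomEquiv K p n R ((algHomEquiv K p n R).symm (g * h))
    simp only [Equiv.apply_symm_apply]
  change lift ((toScheme K).map g') ((toScheme K).map h') ≫
    (Functor.LaxMonoidal.μ (toScheme K) _ _ ≫ (toScheme K).map MonObj.mul) = _
  rw [Functor.Monoidal.lift_μ_assoc, ← Functor.map_comp, hmul]
  rfl

theorem grpPt_one : toUnit (aff R) ≫ MonObj.one = grpPt (1 : Points K p n R) := by
  have hone : toUnit (op R) ≫ MonObj.one =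
      (CommAlgCat.ofHom ((algHomEquiv K p n R).symm 1)).op := by
    refine Quiver.Hom.unop_inj (CommAlgCat.hom_ext ((algHomEquiv K p n R).injective ?_))
    refine (algHomEquiv_one (op R)).trans ?_
    exact ((algHomEquiv K p n R).apply_symm_apply 1).symm
  have h₁ : toUnit (aff R) =
      (toScheme K).map (toUnit (op R)) ≫ Functor.OplaxMonoidal.η (toScheme K) := toUnit_unique _ _
  have h₂ : ((toScheme K).map (toUnit (op R)) ≫ Functor.OplaxMonoidal.η (toScheme K)) ≫
      Functor.LaxMonoidal.ε (toScheme K) ≫ (toScheme K).map (MonObj.one (X := affG K p n)) =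
      (toScheme K).map (toUnit (op R) ≫ MonObj.one) := by
    rw [Category.assoc, Functor.Monoidal.η_ε_assoc, Functor.map_comp]
  rw [h₁]
  refine h₂.trans ?_
  rw [hone]
  rfl

theorem linePt_smul (g : Points K p n R) (a : R) :
    lift (grpPt g) (linePt a) ≫
      (ModObj.smul (M := G K p n) (X := A1 K) : G K p n ⊗ A1 K ⟶ A1 K) = linePt (K := K) (g.act a) := by
  let g' : op R ⟶ affG K p n := (CommAlgCat.ofHom ((algHomEquiv K p n R).symm g)).op
  let a' : op R ⟶ affLine K := (CommAlgCat.ofHom (Polynomial.aeval a)).op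
  have hact : lift g' a' ≫
      (ModObj.smul (M := affG K p n) (X := affLine K) : affG K p n ⊗ affLine K ⟶ affLine K) =
      (CommAlgCat.ofHom (Polynomial.aeval (g.act a))).op := by
    change lift g' a' ≫ actHom (fst _ _) (snd _ _) = _
    rw [comp_actHom, lift_fst, lift_snd]
    change (lineEquiv (op R)).symm ((algHomEquiv K p n R ((algHomEquiv K p n R).symm g)).act
      (Polynomial.aeval a Polynomial.X)) = (lineEquiv (op R)).symm (g.act a)
    rw [Equiv.apply_symm_apply, Polynomial.aeval_X]
  change lift ((toScheme K).map g') ((toScheme K).map a') ≫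
    (Functor.LaxMonoidal.μ (toScheme K) _ _ ≫ (toScheme K).map
      (ModObj.smul (M := affG K p n) (X := affLine K) : affG K p n ⊗ affLine K ⟶ affLine K)) = _
  rw [Functor.Monoidal.lift_μ_assoc, ← Functor.map_comp, hact]
  rfl

/-! ### The action laws and equivariance of the line chart. -/

section Laws

variable {act : G K p n ⊗ X K p n ⟶ X K p n}

theorem comp_lift_act {Z Z' : Over (Spec (.of K))} (f : Z ⟶ Z') (g : Z' ⟶ G K p n)
    (x : Z' ⟶ X K p n) : f ≫ lift g x ≫ act = lift (f ≫ g) (f ≫ x) ≫ act := by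
  rw [← Category.assoc, comp_lift]

theorem one_act_of_rel
    (hact : ∀ (R : CommAlgCat.{u} K) (g : Points K p n R) (x y : aff R ⟶ X K p n),
      ActRel g x y → lift (grpPt g) x ≫ act = y)
    {Z : Over (Spec (.of K))} (x : Z ⟶ X K p n) :
    lift (toUnit Z ≫ MonObj.one) x ≫ act = x := by
  refine over_hom_ext_local fun w => ?_
  obtain ⟨R, j, z, hj, hz, h⟩ := exists_local_chart x w
  refine ⟨aff R, j, hj, ⟨z, hz⟩, ?_⟩
  rw [comp_lift_act, ← Category.assoc, toUnit_unique (j ≫ toUnit Z) (toUnit (aff R)), grpPt_one]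
  refine hact R _ _ _ ?_
  rcases h with ⟨a, h⟩ | ⟨χ, h, -⟩
  · have := ActRel.line (g := (1 : Points K p n R)) a
    rw [Points.one_act] at this
    rwa [h]
  · rw [h]
    exact .semi (Points.isTransform_one χ)

/-- Checked on small affine opens. On the line chart no shrinking is needed; at infinity the source
is shrunk twice, first for the denominator of `h` and then for that of `g`. -/
theorem mul_act_of_rel
    (hact : ∀ (R : CommAlgCat.{u} K) (g : Points K p n R) (x y : aff R ⟶ X K p n),
      ActRel g x y → lift (grpPt g) x ≫ act = y)
    {Z : Over (Spec (.of K))} (g h : Z ⟶ G K p n) (x : Z ⟶ X K p n) :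
    lift (lift g h ≫ MonObj.mul) x ≫ act = lift g (lift h x ≫ act) ≫ act := by
  refine over_hom_ext_local fun w => ?_
  obtain ⟨R, j, z, hj, hz, H⟩ := exists_local_chart x w
  obtain ⟨g₀, hg⟩ := grpPt_surjective (j ≫ g)
  obtain ⟨h₀, hh⟩ := grpPt_surjective (j ≫ h)
  have key : ∀ {A : CommAlgCat.{u} K} (k : aff A ⟶ Z) (g₁ h₁ : Points K p n A)
      (y y' : aff A ⟶ X K p n), k ≫ g = grpPt g₁ → k ≫ h = grpPt h₁ → ActRel h₁ (k ≫ x) y →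
      ActRel g₁ y y' → ActRel (g₁ * h₁) (k ≫ x) y' →
      k ≫ lift (lift g h ≫ MonObj.mul) x ≫ act = k ≫ lift g (lift h x ≫ act) ≫ act := by
    intro A k g₁ h₁ y y' hg₁ hh₁ hy hy' hyy'
    rw [comp_lift_act, comp_lift_act, comp_lift_act, ← Category.assoc, comp_lift, hg₁, hh₁,
      grpPt_mul, hact A _ _ _ hyy', hact A _ _ _ hy, hact A _ _ _ hy']
  rcases H with ⟨a, H⟩ | ⟨χ, H, hmem⟩
  · refine ⟨aff R, j, hj, ⟨z, hz⟩, key j g₀ h₀ _ _ hg.symm hh.symm ?_ (.line (h₀.act a)) ?_⟩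
    · rw [H]
      exact .line a
    · rw [H, ← Points.mul_act]
      exact .line a
  -- The output `hmem₁` is the hypothesis needed to transform `ψ` by `g` at the next step.
  · obtain ⟨R₁, f₁, z₁, ψ, hf₁, hz₁, hψ, hmem₁⟩ := exists_local_transform h₀ χ z hmem
    obtain ⟨R₂, f₂, z₂, ω, hf₂, hz₂, hω, -⟩ :=
      exists_local_transform (Points.map f₁.hom g₀) ψ z₁ hmem₁
    have hψ' := hψ.map f₂.hom
    have e : (affMap f₂ ≫ affMap f₁ ≫ j) ≫ x =
        semiPt ((f₂.hom : R₁ →* R₂).comp ((f₁.hom : R →* R₁).comp χ)) ≫ semiIncl K p n := by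
      rw [Category.assoc, Category.assoc, H, ← affMap_semiPt, ← affMap_semiPt, Category.assoc,
        Category.assoc]
    have eg : ∀ (g : Z ⟶ G K p n) (g₀ : Points K p n R), grpPt g₀ = j ≫ g →
        (affMap f₂ ≫ affMap f₁ ≫ j) ≫ g = grpPt (Points.map f₂.hom (Points.map f₁.hom g₀)) :=
      fun g g₀ hg => by
        rw [Category.assoc, Category.assoc, ← hg, affMap_grpPt, affMap_grpPt]
    refine ⟨aff R₂, affMap f₂ ≫ affMap f₁ ≫ j, ?_, ⟨z₂, ?_⟩,
      key _ _ _ _ _ (eg g g₀ hg) (eg h h₀ hh) (e ▸ .semi hψ') (.semi hω)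
        (e ▸ .semi (hψ'.mul hω))⟩
    · exact inferInstanceAs
        (IsOpenImmersion ((affMap f₂).left ≫ (affMap f₁).left ≫ j.left))
    · rw [← hz, ← hz₁, ← hz₂]
      rfl

/-- Points of the line chart are always related to their images under `Points.act`, so affine points
can be compared without shrinking. -/
theorem smul_ι_of_rel
    (hact : ∀ (R : CommAlgCat.{u} K) (g : Points K p n R) (x y : aff R ⟶ X K p n),
      ActRel g x y → lift (grpPt g) x ≫ act = y) :
    (ModObj.smul (M := G K p n) (X := A1 K) : G K p n ⊗ A1 K ⟶ A1 K) ≫ ι K p n =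
      G K p n ◁ ι K p n ≫ act := by
  refine over_hom_ext_points fun R j => ?_
  obtain ⟨g, hg⟩ := grpPt_surjective (j ≫ fst _ _)
  obtain ⟨a, ha⟩ := linePt_surjective (j ≫ snd _ _)
  obtain rfl : j = lift (grpPt g) (linePt a) :=
    CartesianMonoidalCategory.hom_ext _ _ (by rw [hg, lift_fst]) (by rw [ha, lift_snd])
  rw [← Category.assoc, linePt_smul, lift_whiskerLeft_assoc, hact R _ _ _ (.line a)]

end Laws

end Action

variable (K : Type u) [Field K] (p : ℕ) [Fact p.Prime] [CharP K p] (n : ℕ) in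
/-- The action of `𝔾_a ⋊ U_n ⋊ 𝔾_m` on the affine line extends to `X_{p,n}`. -/
theorem exists_modObj_isModHom_ι : ∃ act : ModObj (G K p n) (X K p n),
    letI := act
    IsModHom (G K p n) (ι K p n) := by
  obtain ⟨act, hact⟩ := exists_actMor K p n
  let A : ModObj (G K p n) (X K p n) := modObjOfNatural (fun g x => lift g x ≫ act)
    comp_lift_act (one_act_of_rel hact) (mul_act_of_rel hact)
  have hA : (ModObj.smul (M := G K p n) (X := X K p n) : G K p n ⊗ X K p n ⟶ X K p n) = act := by
    change lift (fst _ _) (snd _ _) ≫ act = act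
    rw [lift_fst_snd, Category.id_comp]
  refine ⟨A, ⟨(smul_ι_of_rel hact).trans ?_⟩⟩
  rw [← hA]
  rfl

end

end SkewAction

theorem theorem5p4 (K : Type u) [Field K] (p : ℕ) [Fact p.Prime] [CharP K p] (n : ℕ) :
    ∃ act : ModObj (SkewAction.G K p n) (SkewAction.X K p n),
      letI := act
      IsModHom (SkewAction.G K p n) (SkewAction.ι K p n) := 
  SkewAction.exists_modObj_isModHom_ι K p n
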